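/- Let $m$ be a positive integer and $\mathbb{F}\in\{\mathbb{R},\mathbb{C}\}$. Let $V_1,\dots,V_m$ be 2-dimensional $\mathbb{F}$-vector spaces, $V^*=V_1^*\otimes\cdots\otimes V_m^*$, and for a line $\ell\subset V_j$ let $\Sigma^0_{j,\ell}\subset V^*$ be the annihilator of $V_1\otimes\cdots\otimes V_{j-1}\otimes\ell\otimes V_{j+1}\otimes\cdots\otimes V_m$. A factorization structure of dimension $m$ over $\mathbb{F}$ is an injective linear map $\varphi:\mathfrak{h}\to V^*$ with $\dim\mathfrak{h}=m+1$ such that for every $j\in\{1,\dots,m\}$ one has $\dim(\varphi(\mathfrak{h})\cap\Sigma^0_{j,\ell})=1$ for generic $\ell\in\mathbb{P}(V_j)$, that is, for all $\ell$ in some non-empty Zariski-open subset. Its factorization curve $\psi_j:\mathbb{P}(V_j)\to\mathbb{P}(\mathfrak{h})$ is the unique regular map with $\psi_j(\ell)=\varphi^{-1}(\varphi(\mathfrak{h})\cap\Sigma^0_{j,\ell})$ for generic $\ell$, and $\deg\psi_j$ is the common degree of homogeneous polynomials without non-constant common factor that give $\psi_j$ in homogeneous coordinates. Two factorization curves $\psi_i,\psi_j$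 are equivalent if they have the same image, and $\psi_j$ is decomposable if the number of indices $i\in\{1,\dots,m\}$ such that $\psi_i$ is equivalent to $\psi_j$ is $\deg\psi_j$. Let $\varphi:\mathfrak{h}\to V^*$ be a factorization structure of dimension $m$ over $\mathbb{R}$, let $\varphi^{\mathbb{C}}:\mathfrak{h}\otimes\mathbb{C}\to(V_1\otimes\mathbb{C})^*\otimes_{\mathbb{C}}\cdots\otimes_{\mathbb{C}}(V_m\otimes\mathbb{C})^*$ be its complexification, which is a factorization structure over $\mathbb{C}$, and let $j\in\{1,\dots,m\}$. Denote by $\psi_j$ the $j$-th factorization curve of $\varphi$ and by $\psi_j^{\mathbb{C}}$ the $j$-th factorization curve of $\varphi^{\mathbb{C}}$ (the complexification of $\psi_j$). Then the following hold. 1. $\psi_j$ is decomposable if and only if $\psi_j^{\mathbb{C}}$ is decomposable. 2. $\psi_j$ is decomposable if and only if there exist a subset $S\subset\{1,\dots,m\}$ of cardinality $\deg\psi_j$, a 1-dimensional subspace $\Gamma_j\subset\bigotimes_{r\notin S}V_r^*$, and for each $r\in S$ an invertible (real) projective transformation $g_r:\mathbb{P}(V_j^*)\to\mathbb{P}(V_r^*)$,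 such that for all $\ell\in\mathbb{P}(V_j)$ the line $\varphi(\psi_j(\ell))$ is the tensor product with $g_r\ell^0$ in the $r$-th slot for each $r\in S$ and $\Gamma_j$ in the remaining slots, where $\ell^0\subset V_j^*$ is the annihilator of $\ell$. Moreover, for all such data, $j\in S$ and $g_j=\mathrm{id}_{\mathbb{P}(V_j^*)}$. -/

import Mathlib

open Module
open scoped TensorProduct LinearAlgebra.Projectivization

noncomputable section

namespace FactorizationStructure

/-! ### Zariski-generic conditions and regular maps on projective lines -/

section Projective

variable {F : Type*} [Field F] {A B : Type*} [AddCommGroup A] [Module F A]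
  [AddCommGroup B] [Module F B]

/-- A subset of the projective space `ℙ(A)` is Zariski open if its complement is the common zero
locus of a family of homogeneous polynomials in linear coordinates on `A`. -/
def IsZariskiOpen (U : Set (ℙ F A)) : Prop :=
  ∃ (n : ℕ) (b : Basis (Fin n) F A) (I : Set (MvPolynomial (Fin n) F)),
    (∀ f ∈ I, ∃ d, f.IsHomogeneous d) ∧
    ∀ (v : A) (hv : v ≠ 0),
      Projectivization.mk F v hv ∈ U ↔ ∃ f ∈ I, MvPolynomial.eval (⇑(b.repr v)) f ≠ 0

/-- A condition holds generically on `ℙ(A)` if it holds on a nonempty Zariski-open subset. -/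
def Generically (p : ℙ F A → Prop) : Prop :=
  ∃ U : Set (ℙ F A), IsZariskiOpen U ∧ U.Nonempty ∧ ∀ ℓ ∈ U, p ℓ

/-- `ψ : ℙ(A) → ℙ(B)`, with `A` of dimension two, is a regular map of degree `d`:
in homogeneous coordinates `[x : y]` on `ℙ(A)` and on `ℙ(B)` it is
`[x : y] ↦ [f₁(x, y) : ⋯ : fₖ(x, y)]` for homogeneous polynomials `f₁, …, fₖ` of degree `d`
without nonconstant common factor. Equivalently, `ψ^* 𝒪(1) ≅ 𝒪(d)`, and the `fᵢ` are the
corresponding global sections of `𝒪(d)`. -/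
def IsRegularOfDegree (ψ : ℙ F A → ℙ F B) (d : ℕ) : Prop :=
  ∃ (k : ℕ) (b : Basis (Fin 2) F A) (c : Basis (Fin k) F B)
    (f : Fin k → MvPolynomial (Fin 2) F),
    (∀ i, (f i).IsHomogeneous d) ∧
    (∀ p : MvPolynomial (Fin 2) F, (∀ i, p ∣ f i) → IsUnit p) ∧
    ∀ (v : A) (hv : v ≠ 0),
      (ψ (Projectivization.mk F v hv)).submodule =
        F ∙ (∑ i, MvPolynomial.eval (⇑(b.repr v)) (f i) • c i)

/-- `ψ` is a regular map from the projective line `ℙ(A)` to `ℙ(B)`. -/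
def IsRegular (ψ : ℙ F A → ℙ F B) : Prop :=
  ∃ d, IsRegularOfDegree ψ d

/-- The degree of a regular map from a projective line (over an infinite field there is exactly
one `d` as in the definition). -/
def degree (ψ : ℙ F A → ℙ F B) : ℕ :=
  sInf {d | IsRegularOfDegree ψ d}

end Projective

/-! ### Factorization structures and factorization curves -/

section Structure

variable {F : Type*} [Field F] {m : ℕ} {V : Fin m → Type*} [∀ r, AddCommGroup (V r)]
  [∀ r, Module F (V r)] {H : Type*} [AddCommGroup H] [Module F H]

/-- `Σ_{j,ℓ} = V₁ ⊗ ⋯ ⊗ ℓ ⊗ ⋯ ⊗ Vₘ ⊆ V₁ ⊗ ⋯ ⊗ Vₘ`, with `ℓ` in the `j`-th slot. -/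
def slotSubspace (j : Fin m) (ℓ : ℙ F (V j)) : Submodule F (⨂[F] r, V r) :=
  Submodule.span F
    {t | ∃ v : ∀ r, V r, v j ∈ ℓ.submodule ∧ t = PiTensorProduct.tprod F v}

/-- `Σ⁰_{j,ℓ}`, the annihilator of `Σ_{j,ℓ}` in `V^* = V₁^* ⊗ ⋯ ⊗ Vₘ^*`. -/
def slotAnnihilator (j : Fin m) (ℓ : ℙ F (V j)) : Submodule F (⨂[F] r, Dual F (V r)) :=
  (slotSubspace j ℓ).dualAnnihilator.comap PiTensorProduct.dualDistrib

/-- A factorization structure of dimension `m`: an injective linear map `φ : H → V₁^* ⊗ ⋯ ⊗ Vₘ^*`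
with all `V_r` of dimension two and `H` of dimension `m + 1`, such that for every `j` the
intersection `φ(H) ∩ Σ⁰_{j,ℓ}` is one-dimensional for generic `ℓ ∈ ℙ(V_j)`. -/
structure IsFactorizationStructure (φ : H →ₗ[F] ⨂[F] r, Dual F (V r)) : Prop where
  finrank_slot : ∀ r, finrank F (V r) = 2
  finrank_source : finrank F H = m + 1
  injective : Function.Injective φ
  generic : ∀ j, Generically fun ℓ : ℙ F (V j) =>
    finrank F ↥(LinearMap.range φ ⊓ slotAnnihilator j ℓ) = 1

/-- `ψ : ℙ(V_j) → ℙ(H)` is a regular map that extends the generically defined map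
`ℓ ↦ φ⁻¹(φ(H) ∩ Σ⁰_{j,ℓ})`. -/
def IsFactorizationCurve (φ : H →ₗ[F] ⨂[F] r, Dual F (V r)) (j : Fin m)
    (ψ : ℙ F (V j) → ℙ F H) : Prop :=
  IsRegular ψ ∧ Generically fun ℓ : ℙ F (V j) =>
    (ψ ℓ).submodule = (LinearMap.range φ ⊓ slotAnnihilator j ℓ).comap φ

/-- The `j`-th factorization curve `ψ_j : ℙ(V_j) → ℙ(H)`: the regular extension (which exists
and is unique for a real or complex factorization structure) of the generically defined map
`ℓ ↦ φ⁻¹(φ(H) ∩ Σ⁰_{j,ℓ})`. -/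
def factorizationCurve [Nontrivial H] (φ : H →ₗ[F] ⨂[F] r, Dual F (V r)) (j : Fin m) :
    ℙ F (V j) → ℙ F H :=
  Classical.epsilon (IsFactorizationCurve φ j)

/-- Two factorization curves `ψ_i`, `ψ_j` are equivalent if they have the same image. -/
def Equivalent [Nontrivial H] (φ : H →ₗ[F] ⨂[F] r, Dual F (V r)) (i j : Fin m) : Prop :=
  Set.range (factorizationCurve φ i) = Set.range (factorizationCurve φ j)

/-- The factorization curve `ψ_j` is decomposable if its equivalence class (among the indexed
curves `ψ₁, …, ψₘ`) has cardinality `deg ψ_j`. -/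
def IsDecomposable [Nontrivial H] (φ : H →ₗ[F] ⨂[F] r, Dual F (V r)) (j : Fin m) : Prop :=
  {i : Fin m | Equivalent φ i j}.ncard = degree (factorizationCurve φ j)

/-! ### Decomposed form of a curve -/

/-- The linear map `⨂_{r ∉ S} W_r → ⨂_r W_r` that puts the vectors `a r` in the slots `r ∈ S`
(the values `a r` for `r ∉ S` are not used). -/
def fillSlots {W : Fin m → Type*} [∀ r, AddCommGroup (W r)] [∀ r, Module F (W r)]
    (S : Finset (Fin m)) (a : ∀ r, W r) :
    (⨂[F] r : {r : Fin m // r ∉ S}, W r) →ₗ[F] ⨂[F] r, W r :=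
  PiTensorProduct.lift
    ((PiTensorProduct.tprod F).domDomRestrict (fun r => r ∉ S) (fun r => a r))

/-- The subspace of `⨂_r W_r` with the subspace `L r` in the slot `r`, for each `r ∈ S`, and the
subspace `Γ ⊆ ⨂_{r ∉ S} W_r` in the remaining slots. -/
def slotProduct {W : Fin m → Type*} [∀ r, AddCommGroup (W r)] [∀ r, Module F (W r)]
    (S : Finset (Fin m)) (L : ∀ r ∈ S, Submodule F (W r))
    (Γ : Submodule F (⨂[F] r : {r : Fin m // r ∉ S}, W r)) : Submodule F (⨂[F] r, W r) :=
  Submodule.span F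
    {x | ∃ a : ∀ r, W r, (∀ (r : Fin m) (hr : r ∈ S), a r ∈ L r hr) ∧
      ∃ t ∈ Γ, x = fillSlots S a t}

/-- The set of slots `S`, the one-dimensional `Γ ⊆ ⨂_{r ∉ S} V_r^*`, and the invertible projective
transformations `ℙ(V_j^*) → ℙ(V_r^*)`, `r ∈ S`, induced by the linear isomorphisms `g r`, exhibit
`ψ_j` in decomposed form: `|S| = deg ψ_j`, and for all `ℓ ∈ ℙ(V_j)`, the line `φ(ψ_j(ℓ))` has
`g_r ℓ⁰` in the slot `r` for each `r ∈ S`, and `Γ` in the other slots. -/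
structure IsDecomposedForm [Nontrivial H] (φ : H →ₗ[F] ⨂[F] r, Dual F (V r)) (j : Fin m)
    (S : Finset (Fin m)) (Γ : Submodule F (⨂[F] r : {r : Fin m // r ∉ S}, Dual F (V r)))
    (g : ∀ r ∈ S, Dual F (V j) ≃ₗ[F] Dual F (V r)) : Prop where
  card_eq : S.card = degree (factorizationCurve φ j)
  finrank_eq_one : finrank F Γ = 1
  curve_eq : ∀ ℓ : ℙ F (V j),
    (factorizationCurve φ j ℓ).submodule.map φ =
      slotProduct S
        (fun r hr => ℓ.submodule.dualAnnihilator.map (g r hr : Dual F (V j) →ₗ[F] Dual F (V r))) Γ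

end Structure

/-! ### Complexification -/

section Complexification

variable {m : ℕ} {V : Fin m → Type*} [∀ r, AddCommGroup (V r)]
  [∀ r, Module ℝ (V r)] {H : Type*} [AddCommGroup H] [Module ℝ H]

/-- The canonical real-linear map
`V₁^* ⊗ ⋯ ⊗ Vₘ^* → (ℂ ⊗ V₁)^* ⊗_ℂ ⋯ ⊗_ℂ (ℂ ⊗ Vₘ)^*`, sending `f₁ ⊗ ⋯ ⊗ fₘ` to the tensor product
of the complex-linear extensions of the `f_r`. -/
def tensorComplexify :
    (⨂[ℝ] r, Dual ℝ (V r)) →ₗ[ℝ] ⨂[ℂ] r, Dual ℂ (ℂ ⊗[ℝ] V r) :=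
  PiTensorProduct.lift
    (((PiTensorProduct.tprod ℂ).restrictScalars ℝ).compLinearMap fun _ => Module.Dual.baseChange ℂ)

/-- The complexification `φ^ℂ : ℂ ⊗ H → (ℂ ⊗ V₁)^* ⊗_ℂ ⋯ ⊗_ℂ (ℂ ⊗ Vₘ)^*` of
`φ : H → V₁^* ⊗ ⋯ ⊗ Vₘ^*`. -/
def complexification (φ : H →ₗ[ℝ] ⨂[ℝ] r, Dual ℝ (V r)) :
    ℂ ⊗[ℝ] H →ₗ[ℂ] ⨂[ℂ] r, Dual ℂ (ℂ ⊗[ℝ] V r) :=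
  (tensorComplexify.comp φ).liftBaseChange ℂ

end Complexification

end FactorizationStructure

end

/-!
The tensors `φ h` are handled through their coordinates, so that a factorization structure becomes
a matrix `A` (`coordMatrix`), and contracting `A z` in the slot `j` with a point `x` of the
projective line becomes a matrix of linear forms in `x` (`slotMatrix`) applied to `z`. Its kernel
is a line for generic `x`. Over `ℝ` the kernel of a matrix `M` of forms is that of `Mᵀ M`, so the
generic kernels are spanned by a family `p` of forms, which can be taken without common factor
(`exists_coprime_kernel`, `IsCurveForm`). A coprime family of forms is determined up to a constant
by the map that it defines (`NoCommonFactor.exists_eq_C_mul`), hence `p` gives the factorization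
curve and its degree (`submodule_factorizationCurve`, `degree_factorizationCurve`). By a
homogeneous Bézout identity (`NoCommonFactor.exists_X_pow_mem`), coprimality survives the passage
to `ℂ`, so the same forms give the curve of the complexification, with the same degree.

Suppose that the image of the real curve `p` lies in that of the `i`-th curve `q`. The tensors on
`p` then have a kernel in the slot `i`, and this kernel is given by a coprime pair of forms `G`
with `q ∘ G = c p` (`IsSubcurve.exists_reparametrization`). This identity remains true over `ℂ`.
Conversely, a complex point of `q` over a real point of `p` spans the kernel of a nonzero real
tensor in the slot `i`, so it is real up to a scalar (`IsSubcurve.of_map_ofReal`). Equivalence of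
curves is therefore the same over `ℝ` and `ℂ`, and so is decomposability.

If `p` and `q` have the same image, then the degrees of the two reparametrizations multiply to one,
so `G` is linear (`exists_linear_reparametrization`). Hence each curve equivalent to `p` splits off
a linear pair of forms from the tensors on `p`, which have degree `deg p` in the parameter. There
are thus at most `deg p` such curves, and if there are exactly so many, then what remains is a
constant tensor (`card_le_and_exists_const`): this is the decomposed form. Conversely, in a
decomposed form the slots in `S` all belong to curves equivalent to `p`
(`IsDecomposedForm.equivalent`), so that the equivalence class has at least `deg p` members. The
tensors at the parameter `ℓ` vanish on `ℓ` in the slot `j`; this forces `j ∈ S`, as `Γ` does not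
depend on `ℓ`, and forces `g_j` to fix `ℓ⁰`.
-/

noncomputable section

namespace FactorizationStructure

open MvPolynomial

/-! ### Coprime families of binary forms -/

section BinaryForms

variable {F : Type*} [Field F] {κ : Type*}

/-- The members of the family `f` have no nonconstant common factor. -/
def NoCommonFactor (f : κ → MvPolynomial (Fin 2) F) : Prop :=
  ∀ p, (∀ i, p ∣ f i) → IsUnit p

theorem homogeneousComponent_add_mul {σ : Type*} {a b : MvPolynomial σ F} {e : ℕ}
    (ha : a.IsHomogeneous e) (n : ℕ) :
    homogeneousComponent (e + n) (a * b) = a * homogeneousComponent n b := by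
  let _ : GradedAlgebra (homogeneousSubmodule σ F) := MvPolynomial.gradedAlgebra
  have h := DirectSum.coe_decompose_mul_add_of_left_mem (homogeneousSubmodule σ F)
    (a := a) (b := b) (i := e) (j := n) ha
  have hd : ∀ (φ : MvPolynomial σ F) (i : ℕ),
      (DirectSum.decompose (homogeneousSubmodule σ F) φ i : MvPolynomial σ F) =
        homogeneousComponent i φ := decomposition.decompose'_apply
  rwa [hd, hd] at h

theorem exists_homogeneousComponent_ne_zero {σ : Type*} {f : MvPolynomial σ F} (hf : f ≠ 0) :
    ∃ n ≤ f.totalDegree, homogeneousComponent n f ≠ 0 := by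
  by_contra! h
  refine hf ?_
  rw [← sum_homogeneousComponent f]
  exact Finset.sum_eq_zero fun n hn => h n (Nat.lt_succ_iff.mp (Finset.mem_range.mp hn))

/-- A polynomial that vanishes wherever a nonzero polynomial does not vanish is zero. -/
theorem eq_zero_of_eval_eq_zero_off [Infinite F] {σ : Type*} {f g : MvPolynomial σ F}
    (hf : f ≠ 0) (h : ∀ x, eval x f ≠ 0 → eval x g = 0) : g = 0 := by
  have : f * g = 0 := by
    refine MvPolynomial.funext fun x => ?_
    by_cases hx : eval x f = 0
    · simp [hx]
    · simp [h x hx]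
  exact (mul_eq_zero.mp this).resolve_left hf

theorem NoCommonFactor.exists_ne_zero {f : κ → MvPolynomial (Fin 2) F} (hf : NoCommonFactor f) :
    ∃ k, f k ≠ 0 := by
  by_contra! h
  exact not_isUnit_zero (hf 0 fun i => by simp [h i])

/-- A family that is proportional to a coprime family is a multiple of it. -/
theorem NoCommonFactor.exists_eq_mul [Finite κ] {f h : κ → MvPolynomial (Fin 2) F}
    (hf : NoCommonFactor f) (hc : ∀ k l, h k * f l = h l * f k) :
    ∃ c, ∀ k, h k = c * f k := by
  classical
  cases nonempty_fintype κ
  obtain ⟨k₀, hk₀⟩ := hf.exists_ne_zero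
  let _ : StrongNormalizationMonoid (MvPolynomial (Fin 2) F) :=
    UniqueFactorizationMonoid.strongNormalizationMonoid
  let _ : StrongNormalizedGCDMonoid (MvPolynomial (Fin 2) F) :=
    UniqueFactorizationMonoid.toStrongNormalizedGCDMonoid _
  -- `f k₀` divides all `h k₀ * f l`, hence also `h k₀`, as the `f l` have unit gcd.
  have h1 : f k₀ ∣ Finset.univ.gcd fun l => h k₀ * f l :=
    Finset.dvd_gcd fun l _ => ⟨h l, by rw [hc k₀ l, mul_comm]⟩
  rw [Finset.gcd_mul_left] at h1
  have hu : IsUnit (Finset.univ.gcd f) := hf _ fun i => Finset.gcd_dvd (Finset.mem_univ i)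
  have h2 : f k₀ ∣ h k₀ := by
    have := (hu.dvd_mul_right).mp h1
    exact (dvd_normalize_iff).mp this
  obtain ⟨c, hc'⟩ := h2
  refine ⟨c, fun k => ?_⟩
  apply mul_right_cancel₀ hk₀
  rw [← hc k₀ k, hc']
  ring

/-- A coprime family of forms is determined up to a constant by the map that it defines. -/
theorem NoCommonFactor.exists_eq_C_mul [Finite κ] {f h : κ → MvPolynomial (Fin 2) F}
    (hf : NoCommonFactor f) (hh : NoCommonFactor h) (hc : ∀ k l, h k * f l = h l * f k) :
    ∃ c : F, c ≠ 0 ∧ ∀ k, h k = C c * f k := by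
  obtain ⟨c, hc'⟩ := hf.exists_eq_mul hc
  have hu : IsUnit c := hh c fun i => ⟨_, hc' i⟩
  obtain ⟨a, ha, rfl⟩ := MvPolynomial.isUnit_iff_eq_C_of_isReduced.mp hu
  exact ⟨a, ha.ne_zero, hc'⟩

theorem NoCommonFactor.degree_eq {f h : κ → MvPolynomial (Fin 2) F} {d e : ℕ}
    (hf : NoCommonFactor f) (hfd : ∀ k, (f k).IsHomogeneous d) (hhe : ∀ k, (h k).IsHomogeneous e)
    {c : F} (hc0 : c ≠ 0) (hc : ∀ k, h k = C c * f k) : e = d := by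
  obtain ⟨k, hk⟩ := hf.exists_ne_zero
  have h1 : (h k).IsHomogeneous d := by
    rw [hc k]; simpa using (hfd k).C_mul c
  refine (hhe k).inj_right h1 ?_
  rw [hc k]
  exact mul_ne_zero (by simpa using hc0) hk

/-! ### The homogeneous Bézout identity -/

/-- The dehomogenization `f(X, 1)` or `f(1, X)`: the variable `X a` is set to one. -/
def dehomogenize (a : Fin 2) : MvPolynomial (Fin 2) F →ₐ[F] Polynomial F :=
  aeval fun c => if c = a then 1 else Polynomial.X

/-- The form of degree `n` with dehomogenization `g`, for `n ≥ deg g`. -/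
def homogenize (a : Fin 2) (n : ℕ) (g : Polynomial F) : MvPolynomial (Fin 2) F :=
  ∑ k ∈ Finset.range (n + 1), C (g.coeff k) * (X (1 - a) ^ k * X a ^ (n - k))

theorem homogenize_isHomogeneous (a : Fin 2) (n : ℕ) (g : Polynomial F) :
    (homogenize a n g).IsHomogeneous n := by
  refine IsHomogeneous.sum _ _ _ fun k hk => IsHomogeneous.C_mul ?_ _
  have := (isHomogeneous_X_pow (R := F) (1 - a) k).mul (isHomogeneous_X_pow (R := F) a (n - k))
  rwa [Nat.add_sub_cancel' (Nat.lt_succ_iff.mp (Finset.mem_range.mp hk))] at this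

theorem dehomogenize_homogenize (a : Fin 2) {n : ℕ} {g : Polynomial F} (hg : g.natDegree ≤ n) :
    dehomogenize a (homogenize a n g) = g := by
  have ha : (1 - a) ≠ a := by fin_cases a <;> decide
  conv_rhs => rw [g.as_sum_range' (n + 1) (Nat.lt_succ_iff.mpr hg)]
  simp only [homogenize, map_sum, map_mul, map_pow]
  refine Finset.sum_congr rfl fun k _ => ?_
  simp [dehomogenize, ha, ← Polynomial.C_mul_X_pow_eq_monomial]

theorem eval_dehomogenize (a : Fin 2) (f : MvPolynomial (Fin 2) F) (t : F) :
    (dehomogenize a f).eval t = eval (fun c => if c = a then 1 else t) f := by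
  rw [dehomogenize, ← Polynomial.coe_evalRingHom, ← MvPolynomial.coe_aeval_eq_eval]
  simp only [MvPolynomial.aeval_def, RingHom.coe_coe]
  rw [MvPolynomial.hom_eval₂]
  congr 1
  · ext; simp
  · ext c; by_cases h : c = a <;> simp [h]

theorem eval_smul_of_isHomogeneous {σ : Type*} {f : MvPolynomial σ F} {n : ℕ}
    (hf : f.IsHomogeneous n) (t : F) (x : σ → F) : eval (t • x) f = t ^ n * eval x f := by
  rw [eval_eq, eval_eq, Finset.mul_sum]
  refine Finset.sum_congr rfl fun d hd => ?_
  have hdeg : ∑ i ∈ d.support, d i = n := (hf.degree_eq_sum_deg_support hd).symm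
  simp only [Pi.smul_apply, smul_eq_mul, mul_pow, Finset.prod_mul_distrib,
    Finset.prod_pow_eq_pow_sum, hdeg]
  ring

theorem eq_zero_of_dehomogenize_eq_zero [Infinite F] (a : Fin 2) {f : MvPolynomial (Fin 2) F}
    {n : ℕ} (hf : f.IsHomogeneous n) (h : dehomogenize a f = 0) : f = 0 := by
  refine eq_zero_of_eval_eq_zero_off (f := X a) (X_ne_zero a) fun x hx => ?_
  rw [eval_X] at hx
  have h1 : x = x a • fun c => if c = a then 1 else (x a)⁻¹ * x (1 - a) := by
    funext c
    by_cases hc : c = a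
    · simp [hc]
    · obtain rfl : c = 1 - a := by revert hc; fin_cases a <;> fin_cases c <;> decide
      simp [hc, mul_inv_cancel_left₀ hx]
  rw [h1, eval_smul_of_isHomogeneous hf, ← eval_dehomogenize, h]
  simp


theorem eq_of_dehomogenize_eq [Infinite F] (a : Fin 2) {f g : MvPolynomial (Fin 2) F}
    {n : ℕ} (hf : f.IsHomogeneous n) (hg : g.IsHomogeneous n)
    (h : dehomogenize a f = dehomogenize a g) : f = g :=
  sub_eq_zero.mp <| eq_zero_of_dehomogenize_eq_zero a (hf.sub hg) (by rw [map_sub, h, sub_self])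

theorem natDegree_dehomogenize_le (a : Fin 2) {f : MvPolynomial (Fin 2) F} {n : ℕ}
    (hf : f.IsHomogeneous n) : (dehomogenize a f).natDegree ≤ n := by
  refine (MvPolynomial.aeval_natDegree_le (m := n) (n := 1) f hf.totalDegree_le _ fun c => ?_).trans
    (by simp)
  by_cases h : c = a <;> simp [h]

/-- The forms in a coprime family generate an ideal that contains powers of both variables. -/
theorem NoCommonFactor.exists_X_pow_mem [Infinite F] [Fintype κ] {f : κ → MvPolynomial (Fin 2) F}
    {d : ℕ} (hf : NoCommonFactor f) (hd : ∀ k, (f k).IsHomogeneous d) (a : Fin 2) :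
    ∃ (N : ℕ) (u : κ → MvPolynomial (Fin 2) F), ∑ k, u k * f k = X a ^ N := by
  -- The ideal of the dehomogenizations is generated by some `g`; homogenizing `g` gives a common
  -- factor of the forms, so that `g` is a unit.
  obtain ⟨g, hg⟩ := (inferInstance :
    (Ideal.span (Set.range fun k => dehomogenize a (f k))).IsPrincipal)
  have hg' : Ideal.span (Set.range fun k => dehomogenize a (f k)) = Ideal.span {g} := hg
  have hdvd : ∀ k, g ∣ dehomogenize a (f k) := fun k =>
    Ideal.mem_span_singleton.mp (hg' ▸ Ideal.subset_span ⟨k, rfl⟩)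
  choose h hh using hdvd
  obtain ⟨k₀, hk₀⟩ := hf.exists_ne_zero
  have hg0 : g ≠ 0 := by
    rintro rfl
    exact hk₀ (eq_zero_of_dehomogenize_eq_zero a (hd k₀) (by rw [hh, zero_mul]))
  have hle : ∀ k, h k = 0 ∨ g.natDegree + (h k).natDegree ≤ d := fun k => by
    by_cases hk : h k = 0
    · exact Or.inl hk
    · right
      rw [← Polynomial.natDegree_mul hg0 hk, ← hh]
      exact natDegree_dehomogenize_le a (hd k)
  have hge : g.natDegree ≤ d := by
    rcases hle k₀ with h0 | h0
    · refine absurd (eq_zero_of_dehomogenize_eq_zero a (hd k₀) ?_) hk₀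
      rw [hh, h0, mul_zero]
    · omega
  have hunit : IsUnit (homogenize a g.natDegree g) := by
    refine hf _ fun k => ⟨homogenize a (d - g.natDegree) (h k), ?_⟩
    refine eq_of_dehomogenize_eq a (hd k) ?_ ?_
    · have := (homogenize_isHomogeneous a g.natDegree g).mul
        (homogenize_isHomogeneous a (d - g.natDegree) (h k))
      rwa [Nat.add_sub_cancel' hge] at this
    · rw [map_mul, dehomogenize_homogenize a le_rfl, dehomogenize_homogenize a, hh]
      rcases hle k with h0 | h0
      · simp [h0]
      · omega
  have hgu : IsUnit g := by
    rw [← dehomogenize_homogenize a (le_refl g.natDegree)]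
    exact hunit.map _
  have h1 : (1 : Polynomial F) ∈ Ideal.span (Set.range fun k => dehomogenize a (f k)) := by
    rw [hg', Ideal.span_singleton_eq_top.mpr hgu]
    trivial
  obtain ⟨c, hc⟩ := (Ideal.mem_span_range_iff_exists_fun).mp h1
  -- The relation `∑ c k * f k = 1` between dehomogenizations is homogenized in degree `n + d`.
  let n := Finset.univ.sup fun k => (c k).natDegree
  refine ⟨n + d, fun k => homogenize a n (c k), ?_⟩
  refine eq_of_dehomogenize_eq a (IsHomogeneous.sum _ _ _ fun k _ =>
    (homogenize_isHomogeneous a n (c k)).mul (hd k)) (isHomogeneous_X_pow a _) ?_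
  rw [map_sum, map_pow]
  have : dehomogenize a (X a : MvPolynomial (Fin 2) F) = 1 := by simp [dehomogenize]
  rw [this, one_pow, ← hc]
  refine Finset.sum_congr rfl fun k _ => ?_
  rw [map_mul, dehomogenize_homogenize a
    (Finset.le_sup (f := fun k => (c k).natDegree) (Finset.mem_univ k))]

theorem isRelPrime_X_pow (M N : ℕ) :
    IsRelPrime (X 0 ^ M : MvPolynomial (Fin 2) F) (X 1 ^ N) := by
  refine IsRelPrime.pow ?_
  intro p hp hq
  obtain ⟨c, hc⟩ := hp
  rcases (X_prime (R := F) (i := (0 : Fin 2))).irreducible.isUnit_or_isUnit hc with h | h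
  · exact h
  · have : (X 0 : MvPolynomial (Fin 2) F) ∣ X 1 := by
      rw [hc]
      exact (h.mul_right_dvd).mpr hq
    simp [X_dvd_X] at this

/-- Converse of `NoCommonFactor.exists_X_pow_mem`: a common factor would divide powers of both
variables. This criterion is preserved by ring homomorphisms. -/
theorem noCommonFactor_of_X_pow {f : κ → MvPolynomial (Fin 2) F} [Fintype κ]
    (h : ∀ a : Fin 2, ∃ (N : ℕ) (u : κ → MvPolynomial (Fin 2) F), ∑ k, u k * f k = X a ^ N) :
    NoCommonFactor f := by
  intro p hp
  obtain ⟨M, u, hu⟩ := h 0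
  obtain ⟨N, w, hw⟩ := h 1
  refine isRelPrime_X_pow (F := F) M N ?_ ?_
  · rw [← hu]; exact Finset.dvd_sum fun k _ => (hp k).mul_left _
  · rw [← hw]; exact Finset.dvd_sum fun k _ => (hp k).mul_left _

/-- Coprimality of a family of forms persists under field extension. -/
theorem NoCommonFactor.map [Infinite F] [Fintype κ] {K : Type*} [Field K] (i : F →+* K)
    {f : κ → MvPolynomial (Fin 2) F} {d : ℕ} (hf : NoCommonFactor f)
    (hd : ∀ k, (f k).IsHomogeneous d) : NoCommonFactor fun k => MvPolynomial.map i (f k) := by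
  refine noCommonFactor_of_X_pow fun a => ?_
  obtain ⟨N, u, hu⟩ := hf.exists_X_pow_mem hd a
  refine ⟨N, fun k => MvPolynomial.map i (u k), ?_⟩
  simpa using congrArg (MvPolynomial.map i) hu

/-- Coprime forms have no common zero on the projective line. -/
theorem NoCommonFactor.exists_eval_ne_zero [Infinite F] [Fintype κ]
    {f : κ → MvPolynomial (Fin 2) F} {d : ℕ} (hf : NoCommonFactor f)
    (hd : ∀ k, (f k).IsHomogeneous d) {x : Fin 2 → F} (hx : x ≠ 0) : ∃ k, eval x (f k) ≠ 0 := by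
  by_contra! h
  refine hx (funext fun a => ?_)
  obtain ⟨N, u, hu⟩ := hf.exists_X_pow_mem hd a
  have := congrArg (eval x) hu
  simp only [map_sum, map_mul, h, mul_zero, Finset.sum_const_zero, map_pow, eval_X] at this
  exact eq_zero_of_pow_eq_zero this.symm

/-- Substituting a coprime pair of forms into a coprime family of forms gives a coprime family. -/
theorem NoCommonFactor.bind₁ [Infinite F] [Fintype κ]
    {f : κ → MvPolynomial (Fin 2) F} {d : ℕ} (hf : NoCommonFactor f)
    (hd : ∀ k, (f k).IsHomogeneous d) {G : Fin 2 → MvPolynomial (Fin 2) F}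
    (hG : NoCommonFactor G) : NoCommonFactor fun k => MvPolynomial.bind₁ G (f k) := by
  intro p hp
  have key : ∀ a, ∃ N : ℕ, p ∣ G a ^ N := fun a => by
    obtain ⟨N, u, hu⟩ := hf.exists_X_pow_mem hd a
    refine ⟨N, ?_⟩
    have := congrArg (MvPolynomial.bind₁ G) hu
    simp only [map_sum, map_mul, map_pow, bind₁_X_right] at this
    rw [← this]
    exact Finset.dvd_sum fun k _ => (hp k).mul_left _
  obtain ⟨M, hM⟩ := key 0
  obtain ⟨N, hN⟩ := key 1
  have hrel : IsRelPrime (G 0) (G 1) := fun q h0 h1 => hG q fun a => by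
    fin_cases a
    · exact h0
    · exact h1
  exact hrel.pow hM hN

theorem isHomogeneous_bind₁ {f : MvPolynomial (Fin 2) F} {d e : ℕ} (hf : f.IsHomogeneous d)
    {G : Fin 2 → MvPolynomial (Fin 2) F} (hG : ∀ a, (G a).IsHomogeneous e) :
    (MvPolynomial.bind₁ G f).IsHomogeneous (e * d) :=
  hf.aeval G hG

theorem eval_bind₁ {σ τ : Type*} (G : σ → MvPolynomial τ F) (f : MvPolynomial σ F)
    (x : τ → F) : eval x (MvPolynomial.bind₁ G f) = eval (fun a => eval x (G a)) f := by
  rw [← aeval_eq_eval, aeval_bind₁]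
  rfl

end BinaryForms

/-! ### Splitting off slots from a tensor of forms -/

section SlotFactor

variable {F : Type*} [Field F] {m : ℕ}

/-- A function of multi-indices that ignores each slot in `S` ignores all of them at once. -/
theorem apply_piecewise_of_apply_update {β : Type*} {R : (Fin m → Fin 2) → β} {S : Finset (Fin m)}
    (hR : ∀ r ∈ S, ∀ I a, R (Function.update I r a) = R I) (J I : Fin m → Fin 2) :
    R (S.piecewise J I) = R I := by
  classical
  suffices ∀ U : Finset (Fin m), U ⊆ S → R (U.piecewise J I) = R I from this S subset_rfl
  intro U
  induction U using Finset.induction_on with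
  | empty => simp
  | insert u U hu ihU =>
    intro hUS
    rw [Finset.piecewise_insert, hR u (hUS (Finset.mem_insert_self u U)),
      ihU fun v hv => hUS (Finset.mem_insert_of_mem hv)]

/-- Let `T` be the coordinates of a tensor with polynomial entries that, in every slot `r ∈ S`, is
proportional to the coprime pair `c r`. Then `T` is the product of the `c r` with a tensor `R` in
the remaining slots; `R` is indexed by all multi-indices, and ignores the slots in `S`. -/
theorem exists_slot_factorization (T : (Fin m → Fin 2) → MvPolynomial (Fin 2) F)
    (c : Fin m → Fin 2 → MvPolynomial (Fin 2) F) (S : Finset (Fin m))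
    (hc : ∀ r ∈ S, NoCommonFactor (c r))
    (hT : ∀ r ∈ S, ∀ I, T (Function.update I r 0) * c r 1 = T (Function.update I r 1) * c r 0) :
    ∃ R : (Fin m → Fin 2) → MvPolynomial (Fin 2) F,
      (∀ I, T I = (∏ r ∈ S, c r (I r)) * R I) ∧
      ∀ r ∈ S, ∀ I a, R (Function.update I r a) = R I := by
  classical
  induction S using Finset.induction_on with
  | empty => exact ⟨T, fun I => by simp, by simp⟩
  | insert s S hs ih =>
    obtain ⟨R, hR, hRS⟩ := ih (fun r hr => hc r (Finset.mem_insert_of_mem hr))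
      fun r hr => hT r (Finset.mem_insert_of_mem hr)
    have hcs := hc s (Finset.mem_insert_self s S)
    -- `R` does not depend on the slots in `S`, which can be chosen so that `c r (I r) ≠ 0` there.
    have hind : ∀ I J : Fin m → Fin 2, (∀ r ∉ S, I r = J r) → R I = R J := by
      intro I J hIJ
      rw [← apply_piecewise_of_apply_update hRS J I]
      congr 1
      funext r
      by_cases hr : r ∈ S <;> simp [hr, hIJ r]
    have hcne : ∀ r ∈ S, ∃ a, c r a ≠ 0 := fun r hr =>
      (hc r (Finset.mem_insert_of_mem hr)).exists_ne_zero
    choose! α hα using hcne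
    have hprop : ∀ I, R (Function.update I s 0) * c s 1 = R (Function.update I s 1) * c s 0 := by
      intro I
      let J : Fin m → Fin 2 := S.piecewise α I
      have hJ : ∀ a, R (Function.update J s a) = R (Function.update I s a) := fun a => by
        refine hind _ _ fun r hr => ?_
        by_cases hrs : r = s
        · subst hrs; simp
        · simp [hrs, J, hr]
      have h1 := hT s (Finset.mem_insert_self s S) J
      rw [hR, hR] at h1
      have h2 : ∀ a, ∏ r ∈ S, c r (Function.update J s a r) = ∏ r ∈ S, c r (α r) := fun a => by
        refine Finset.prod_congr rfl fun r hr => ?_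
        have : r ≠ s := fun h => hs (h ▸ hr)
        simp [this, J, hr]
      rw [h2, h2, hJ, hJ, mul_assoc, mul_assoc] at h1
      exact mul_left_cancel₀ (Finset.prod_ne_zero_iff.mpr fun r hr => hα r hr) h1
    have hdiv : ∀ I, ∃ q, ∀ a, R (Function.update I s a) = q * c s a := fun I => by
      refine hcs.exists_eq_mul (h := fun a => R (Function.update I s a)) fun k l => ?_
      fin_cases k <;> fin_cases l
      · rfl
      · exact hprop I
      · exact (hprop I).symm
      · rfl
    choose q hq using hdiv
    obtain ⟨a₀, ha₀⟩ := hcs.exists_ne_zero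
    refine ⟨q, fun I => ?_, fun r hr I a => ?_⟩
    · rw [Finset.prod_insert hs, hR I, ← Function.update_eq_self s I, hq I (I s)]
      simp
      ring
    · apply mul_right_cancel₀ ha₀
      rw [← hq, ← hq]
      rcases Finset.mem_insert.mp hr with rfl | hrS
      · simp
      · have : r ≠ s := fun h => hs (h ▸ hrS)
        rw [Function.update_comm this, hRS r hrS]

/-- A nonzero tensor of forms of degree `d` has at most `d` slots from which a linear pair of
forms splits off, and if it has `d` of them then what remains is constant. -/
theorem card_le_and_exists_const (T : (Fin m → Fin 2) → MvPolynomial (Fin 2) F)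
    (c : Fin m → Fin 2 → MvPolynomial (Fin 2) F) (S : Finset (Fin m)) {d : ℕ}
    (hd : ∀ I, (T I).IsHomogeneous d) (hT0 : ∃ I, T I ≠ 0)
    (hc : ∀ r ∈ S, NoCommonFactor (c r)) (hc1 : ∀ r ∈ S, ∀ a, (c r a).IsHomogeneous 1)
    (hT : ∀ r ∈ S, ∀ I, T (Function.update I r 0) * c r 1 = T (Function.update I r 1) * c r 0) :
    S.card ≤ d ∧ (S.card = d → ∃ ρ : (Fin m → Fin 2) → F,
      (∀ I, T I = (∏ r ∈ S, c r (I r)) * C (ρ I)) ∧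
      ∀ r ∈ S, ∀ I a, ρ (Function.update I r a) = ρ I) := by
  classical
  obtain ⟨R, hR, hRS⟩ := exists_slot_factorization T c S hc hT
  have hprod : ∀ I : Fin m → Fin 2, (∏ r ∈ S, c r (I r)).IsHomogeneous S.card := fun I => by
    simpa using IsHomogeneous.prod S (fun r => c r (I r)) (fun _ => 1) fun r hr => hc1 r hr _
  have hdeg : ∀ I, T I ≠ 0 → S.card + (R I).totalDegree = d := fun I hI => by
    have h0 := hI
    rw [hR I] at h0
    have h1 := totalDegree_mul_of_isDomain (left_ne_zero_of_mul h0) (right_ne_zero_of_mul h0)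
    rwa [← hR I, (hd I).totalDegree hI,
      (hprod I).totalDegree (left_ne_zero_of_mul h0), eq_comm] at h1
  obtain ⟨I₀, hI₀⟩ := hT0
  refine ⟨by have := hdeg I₀ hI₀; omega, fun hcard => ?_⟩
  have hcne : ∀ r ∈ S, ∃ a, c r a ≠ 0 := fun r hr => (hc r hr).exists_ne_zero
  choose! α hα using hcne
  have hadj : ∀ I, R (S.piecewise α I) = R I := apply_piecewise_of_apply_update hRS α
  have hconst : ∀ I, ∃ a : F, R I = C a := fun I => by
    by_cases hRI : R I = 0
    · exact ⟨0, by simp [hRI]⟩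
    · have h1 : T (S.piecewise α I) ≠ 0 := by
        rw [hR, hadj]
        refine mul_ne_zero (Finset.prod_ne_zero_iff.mpr fun r hr => ?_) hRI
        simpa [hr] using hα r hr
      have h2 := hdeg _ h1
      rw [hadj] at h2
      exact ⟨_, totalDegree_eq_zero_iff_eq_C.mp (by omega)⟩
  choose ρ hρ using hconst
  refine ⟨ρ, fun I => by rw [hR, hρ], fun r hr I a => C_injective (Fin 2) F ?_⟩
  rw [← hρ, ← hρ, hRS r hr]

end SlotFactor

/-! ### Kernels of matrices of forms -/

section Kernel

variable {ι κ : Type*} [Fintype ι] [Fintype κ]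

theorem exists_kernel_of_generic (M : ι → κ → MvPolynomial (Fin 2) ℝ)
    {f : MvPolynomial (Fin 2) ℝ} (hf : f ≠ 0)
    (h : ∀ x, eval x f ≠ 0 → ∃ z : κ → ℝ, z ≠ 0 ∧ ∀ i, ∑ k, eval x (M i k) * z k = 0) :
    ∃ P : κ → MvPolynomial (Fin 2) ℝ, P ≠ 0 ∧ ∀ i, ∑ k, M i k * P k = 0 := by
  classical
  -- Over `ℝ`, the kernel of `M` is the kernel of the square matrix `Mᵀ M`.
  have hdet : ((Matrix.of M).transpose * Matrix.of M).det = 0 := by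
    refine eq_zero_of_eval_eq_zero_off hf fun x hx => ?_
    obtain ⟨z, hz, hMz⟩ := h x hx
    rw [RingHom.map_det, ← Matrix.exists_mulVec_eq_zero_iff]
    refine ⟨z, hz, ?_⟩
    rw [RingHom.mapMatrix_apply, Matrix.map_mul, ← Matrix.mulVec_mulVec]
    have : ((Matrix.of M).map (eval x)).mulVec z = 0 := by
      funext i
      simpa [Matrix.mulVec, dotProduct] using hMz i
    rw [this, Matrix.mulVec_zero]
  obtain ⟨P, hP, hMP⟩ := Matrix.exists_mulVec_eq_zero_iff.mpr hdet
  refine ⟨P, hP, ?_⟩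
  set w : ι → MvPolynomial (Fin 2) ℝ := (Matrix.of M).mulVec P with hw
  have hsq : ∑ i, w i * w i = 0 := by
    have : dotProduct w w = 0 := by
      conv_lhs => rw [hw, Matrix.dotProduct_mulVec, ← Matrix.mulVec_transpose, ← hw, hw,
        Matrix.mulVec_mulVec, hMP]
      simp
    exact this
  intro i
  have : w i = 0 := by
    refine MvPolynomial.funext fun x => ?_
    have h1 := congrArg (eval x) hsq
    simp only [map_sum, map_mul, map_zero] at h1 ⊢
    have := (Finset.sum_eq_zero_iff_of_nonneg fun i _ => mul_self_nonneg _).mp h1 i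
      (Finset.mem_univ i)
    exact mul_self_eq_zero.mp this
  exact this

/-- If a real matrix of forms of the same degree has nontrivial kernel at generic points, then
a coprime family of forms lies in its kernel. -/
theorem exists_coprime_kernel (M : ι → κ → MvPolynomial (Fin 2) ℝ) {e : ℕ}
    (hM : ∀ i k, (M i k).IsHomogeneous e) {f : MvPolynomial (Fin 2) ℝ} (hf : f ≠ 0)
    (h : ∀ x, eval x f ≠ 0 → ∃ z : κ → ℝ, z ≠ 0 ∧ ∀ i, ∑ k, eval x (M i k) * z k = 0) :
    ∃ (d : ℕ) (p : κ → MvPolynomial (Fin 2) ℝ), (∀ k, (p k).IsHomogeneous d) ∧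
      NoCommonFactor p ∧ ∀ i, ∑ k, M i k * p k = 0 := by
  classical
  let D : ℕ → Prop := fun d => ∃ p : κ → MvPolynomial (Fin 2) ℝ, (∀ k, (p k).IsHomogeneous d) ∧
    p ≠ 0 ∧ ∀ i, ∑ k, M i k * p k = 0
  have hcomp : ∀ (P : κ → MvPolynomial (Fin 2) ℝ) (k₀ : κ), P k₀ ≠ 0 →
      (∀ i, ∑ k, M i k * P k = 0) → ∃ n ≤ (P k₀).totalDegree, D n := by
    intro P k₀ hk₀ hP
    obtain ⟨n, hn, hne⟩ := exists_homogeneousComponent_ne_zero hk₀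
    refine ⟨n, hn, fun k => homogeneousComponent n (P k),
      fun k => homogeneousComponent_isHomogeneous n _, fun h0 => hne (congrFun h0 k₀), fun i => ?_⟩
    have := congrArg (homogeneousComponent (e + n)) (hP i)
    simpa only [map_sum, homogeneousComponent_add_mul (hM i _), map_zero] using this
  obtain ⟨P, hP, hMP⟩ := exists_kernel_of_generic M hf h
  obtain ⟨k₁, hk₁⟩ := Function.ne_iff.mp hP
  have hex : ∃ d, D d := let ⟨n, _, hn⟩ := hcomp P k₁ hk₁ hMP; ⟨n, hn⟩
  -- A kernel vector of least degree has no common factor, as it could be divided by it.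
  obtain ⟨p, hpd, hp0, hMp⟩ := Nat.find_spec hex
  refine ⟨_, p, hpd, fun q hq => ?_, hMp⟩
  choose r hr using hq
  obtain ⟨k₀, hk₀⟩ := Function.ne_iff.mp hp0
  have hq0 : q ≠ 0 := by
    rintro rfl
    exact hk₀ (by rw [hr, zero_mul]; rfl)
  have hr0 : r k₀ ≠ 0 := fun h0 => hk₀ (by rw [hr, h0, mul_zero]; rfl)
  obtain ⟨n, hn, hDn⟩ := hcomp r k₀ hr0 fun i => by
    apply mul_left_cancel₀ hq0
    rw [mul_zero, ← hMp i, Finset.mul_sum]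
    exact Finset.sum_congr rfl fun k _ => by rw [hr k]; ring
  have h1 := Nat.find_min' hex hDn
  have h2 : (p k₀).totalDegree = q.totalDegree + (r k₀).totalDegree := by
    rw [hr k₀, totalDegree_mul_of_isDomain hq0 hr0]
  rw [(hpd k₀).totalDegree hk₀] at h2
  have h3 : q.totalDegree = 0 := by omega
  rw [totalDegree_eq_zero_iff_eq_C] at h3
  rw [h3] at hq0 ⊢
  exact (isUnit_iff_ne_zero.mpr (by simpa using hq0)).map C

end Kernel

/-! ### Factorization curves in coordinates -/

section Coordinates

variable {F : Type*} [Field F] {m : ℕ} {κ : Type*}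

/-- The contraction of the tensor with coordinates `T` with the vector `x` in the slot `j`
vanishes. -/
def ContractsToZero (j : Fin m) (x : Fin 2 → F) (T : (Fin m → Fin 2) → F) : Prop :=
  ∀ I, ∑ a, x a * T (Function.update I j a) = 0

/-- The matrix of linear forms that sends `z` to the contraction of `A z` with the point
`(X 0, X 1)` in the slot `j`. -/
def slotMatrix (A : Matrix (Fin m → Fin 2) κ F) (j : Fin m) (I : Fin m → Fin 2) (k : κ) :
    MvPolynomial (Fin 2) F :=
  ∑ a, C (A (Function.update I j a) k) * X a

theorem slotMatrix_isHomogeneous (A : Matrix (Fin m → Fin 2) κ F) (j : Fin m)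
    (I : Fin m → Fin 2) (k : κ) : (slotMatrix A j I k).IsHomogeneous 1 :=
  IsHomogeneous.sum _ _ _ fun a _ => (isHomogeneous_X F a).C_mul _

/-- The value at `x` of a family of forms. -/
def evalForms (p : κ → MvPolynomial (Fin 2) F) (x : Fin 2 → F) : κ → F := fun k => eval x (p k)

theorem evalForms_smul {p : κ → MvPolynomial (Fin 2) F} {d : ℕ}
    (hp : ∀ k, (p k).IsHomogeneous d) (t : F) (x : Fin 2 → F) :
    evalForms p (t • x) = t ^ d • evalForms p x :=
  funext fun k => eval_smul_of_isHomogeneous (hp k) t x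

/-- Families of forms that are proportional at generic points are proportional. -/
theorem mul_eq_mul_of_generic [Infinite F] {p q : κ → MvPolynomial (Fin 2) F}
    {f : MvPolynomial (Fin 2) F} (hf : f ≠ 0) (h : ∀ x, eval x f ≠ 0 →
      ∃ (z : κ → F) (s t : F), evalForms p x = s • z ∧ evalForms q x = t • z) (k l : κ) :
    p k * q l = p l * q k := by
  refine sub_eq_zero.mp (eq_zero_of_eval_eq_zero_off hf fun x hx => ?_)
  obtain ⟨z, s, t, hs, ht⟩ := h x hx
  have hs' : ∀ k, eval x (p k) = s * z k := congrFun hs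
  have ht' : ∀ k, eval x (q k) = t * z k := congrFun ht
  simp only [map_sub, map_mul, hs', ht']
  ring

variable [Fintype κ]

/-- The matrix `A` has the generic kernels of a factorization structure in the slot `j`: for
generic `x`, the vectors `w` for which `A w` contracts to zero with `x` form a line. -/
def HasGenericKernelLine (A : Matrix (Fin m → Fin 2) κ F) (j : Fin m) : Prop :=
  ∃ f : MvPolynomial (Fin 2) F, f ≠ 0 ∧ ∀ x, eval x f ≠ 0 → ∃ z : κ → F, z ≠ 0 ∧
    ∀ w, ContractsToZero j x (A.mulVec w) ↔ ∃ t : F, w = t • z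

/-- The family `p` of coprime forms of degree `d` gives the `j`-th factorization curve in
homogeneous coordinates. -/
structure IsCurveForm (A : Matrix (Fin m → Fin 2) κ F) (j : Fin m) (d : ℕ)
    (p : κ → MvPolynomial (Fin 2) F) : Prop where
  homogeneous : ∀ k, (p k).IsHomogeneous d
  coprime : NoCommonFactor p
  kernel : ∀ I, ∑ k, slotMatrix A j I k * p k = 0

theorem sum_eval_slotMatrix (A : Matrix (Fin m → Fin 2) κ F) (j : Fin m) (I : Fin m → Fin 2)
    (x : Fin 2 → F) (w : κ → F) : ∑ k, eval x (slotMatrix A j I k) * w k =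
      ∑ a, x a * A.mulVec w (Function.update I j a) := by
  simp only [slotMatrix, Matrix.mulVec, dotProduct, map_sum, map_mul, eval_C, eval_X,
    Finset.sum_mul, Finset.mul_sum]
  rw [Finset.sum_comm]
  exact Finset.sum_congr rfl fun a _ => Finset.sum_congr rfl fun k _ => by ring

theorem contractsToZero_mulVec_iff {A : Matrix (Fin m → Fin 2) κ F} {j : Fin m} {x : Fin 2 → F}
    {w : κ → F} : ContractsToZero j x (A.mulVec w) ↔
      ∀ I, ∑ k, eval x (slotMatrix A j I k) * w k = 0 := by
  simp only [ContractsToZero, sum_eval_slotMatrix]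

theorem IsCurveForm.contractsToZero {A : Matrix (Fin m → Fin 2) κ F} {j : Fin m} {d : ℕ}
    {p : κ → MvPolynomial (Fin 2) F} (hp : IsCurveForm A j d p) (x : Fin 2 → F) :
    ContractsToZero j x (A.mulVec (evalForms p x)) := by
  rw [contractsToZero_mulVec_iff]
  intro I
  simpa [evalForms] using congrArg (eval x) (hp.kernel I)

theorem IsCurveForm.evalForms_ne_zero [Infinite F] {A : Matrix (Fin m → Fin 2) κ F} {j : Fin m}
    {d : ℕ} {p : κ → MvPolynomial (Fin 2) F} (hp : IsCurveForm A j d p) {x : Fin 2 → F}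
    (hx : x ≠ 0) : evalForms p x ≠ 0 := fun h =>
  let ⟨k, hk⟩ := hp.coprime.exists_eval_ne_zero hp.homogeneous hx
  hk (congrFun h k)

theorem ContractsToZero.smul {j : Fin m} {x : Fin 2 → F} {T : (Fin m → Fin 2) → F}
    (h : ContractsToZero j x T) (t : F) : ContractsToZero j x (t • T) := fun I => by
  simp only [Pi.smul_apply, smul_eq_mul, mul_left_comm _ t, ← Finset.mul_sum, h I, mul_zero]

theorem exists_eq_smul_of_det_eq_zero {x y : Fin 2 → F} (hy : y ≠ 0)
    (h : x 0 * y 1 = x 1 * y 0) : ∃ t : F, x = t • y := by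
  by_cases h0 : y 0 = 0
  · have h1 : y 1 ≠ 0 := fun h1 => hy (funext fun a => by fin_cases a <;> assumption)
    refine ⟨x 1 / y 1, funext fun a => ?_⟩
    fin_cases a
    · have : x 0 * y 1 = 0 := by rw [h, h0, mul_zero]
      simp [h0, (mul_eq_zero.mp this).resolve_right h1]
    · simp [h1]
  · refine ⟨x 0 / y 0, funext fun a => ?_⟩
    fin_cases a
    · simp [h0]
    · simp
      field_simp
      rw [h]

/-- A nonzero tensor contracts to zero with at most one point in each slot. -/
theorem ContractsToZero.exists_eq_smul {j : Fin m} {x y : Fin 2 → F} {T : (Fin m → Fin 2) → F}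
    (hT : T ≠ 0) (hx : ContractsToZero j x T) (hy : ContractsToZero j y T) (hy0 : y ≠ 0) :
    ∃ t : F, x = t • y := by
  refine exists_eq_smul_of_det_eq_zero hy0 ?_
  obtain ⟨I, hI⟩ := Function.ne_iff.mp hT
  have h1 := hx I
  have h2 := hy I
  rw [Fin.sum_univ_two] at h1 h2
  by_contra hne
  have hne' := sub_ne_zero.mpr hne
  have e0 : T (Function.update I j 0) = 0 :=
    (mul_eq_zero.mp (by linear_combination y 1 * h1 - x 1 * h2 :
      (x 0 * y 1 - x 1 * y 0) * T (Function.update I j 0) = 0)).resolve_left hne'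
  have e1 : T (Function.update I j 1) = 0 :=
    (mul_eq_zero.mp (by linear_combination x 0 * h2 - y 0 * h1 :
      (x 0 * y 1 - x 1 * y 0) * T (Function.update I j 1) = 0)).resolve_left hne'
  refine hI ?_
  rw [← Function.update_eq_self j I]
  rcases Fin.exists_fin_two.mp ⟨I j, rfl⟩ with h | h <;> rw [h]
  · exact e0
  · exact e1

/-- A coprime family of forms that lies in the kernels at generic points is, up to a constant,
the family that gives the factorization curve. -/
theorem IsCurveForm.unique [Infinite F] {A : Matrix (Fin m → Fin 2) κ F} {j : Fin m} {d e : ℕ}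
    {p q : κ → MvPolynomial (Fin 2) F} (hA : HasGenericKernelLine A j) (hp : IsCurveForm A j d p)
    (hq : NoCommonFactor q) (hqe : ∀ k, (q k).IsHomogeneous e) {f : MvPolynomial (Fin 2) F}
    (hf : f ≠ 0) (h : ∀ x, eval x f ≠ 0 → ContractsToZero j x (A.mulVec (evalForms q x))) :
    e = d ∧ ∃ c : F, c ≠ 0 ∧ ∀ x, evalForms q x = c • evalForms p x := by
  obtain ⟨g, hg, hgz⟩ := hA
  obtain ⟨c, hc, hqp⟩ := hp.coprime.exists_eq_C_mul hq <|
    mul_eq_mul_of_generic (mul_ne_zero hf hg) fun x hx => by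
      rw [map_mul] at hx
      obtain ⟨z, -, hz⟩ := hgz x (right_ne_zero_of_mul hx)
      obtain ⟨s, hs⟩ := (hz _).mp (h x (left_ne_zero_of_mul hx))
      obtain ⟨t, ht⟩ := (hz _).mp (hp.contractsToZero x)
      exact ⟨z, s, t, hs, ht⟩
  refine ⟨hp.coprime.degree_eq hp.homogeneous hqe hc hqp, c, hc, fun x => funext fun k => ?_⟩
  simp [evalForms, hqp]

/-- Factorization curves are not constant: the tensor at a constant value would contract to zero
with all points of the projective line. -/
theorem IsCurveForm.degree_ne_zero [Infinite F] {A : Matrix (Fin m → Fin 2) κ F} {j : Fin m}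
    {d : ℕ} {p : κ → MvPolynomial (Fin 2) F} (hA : ∀ z, A.mulVec z = 0 → z = 0)
    (hp : IsCurveForm A j d p) : d ≠ 0 := by
  rintro rfl
  have hconst : ∀ x y, evalForms p x = evalForms p y := fun x y => funext fun k => by
    have := totalDegree_eq_zero_iff_eq_C.mp (Nat.le_zero.mp (hp.homogeneous k).totalDegree_le)
    simp only [evalForms]
    rw [this, eval_C, eval_C]
  have hz : evalForms p (Pi.single 0 1) = 0 := by
    refine hA _ (funext fun I => ?_)
    have h := hp.contractsToZero (Pi.single (I j) 1) I
    rw [hconst _ (Pi.single 0 1)] at h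
    simpa [Pi.single_apply] using h
  exact hp.evalForms_ne_zero (by simp) hz

/-- Over `ℝ`, the generic kernels extend to a curve given by coprime forms. -/
theorem HasGenericKernelLine.exists_isCurveForm {A : Matrix (Fin m → Fin 2) κ ℝ} {j : Fin m}
    (hA : HasGenericKernelLine A j) : ∃ d p, IsCurveForm A j d p := by
  obtain ⟨f, hf, h⟩ := hA
  obtain ⟨d, p, hpd, hp, hk⟩ := exists_coprime_kernel (slotMatrix A j)
    (slotMatrix_isHomogeneous A j) hf fun x hx => by
      obtain ⟨z, hz, hzk⟩ := h x hx
      exact ⟨z, hz, contractsToZero_mulVec_iff.mp ((hzk z).mpr ⟨1, (one_smul _ _).symm⟩)⟩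
  exact ⟨d, p, hpd, hp, hk⟩

/-- Every point of the projective curve `p` is a point of the projective curve `q`. -/
def IsSubcurve (p q : κ → MvPolynomial (Fin 2) F) : Prop :=
  ∀ x, x ≠ 0 → ∃ y, y ≠ 0 ∧ ∃ t : F, t ≠ 0 ∧ evalForms p x = t • evalForms q y

end Coordinates

/-! ### Complexification in coordinates -/

section Complexify

variable {m : ℕ} {κ : Type*}

theorem slotMatrix_map (A : Matrix (Fin m → Fin 2) κ ℝ) (j : Fin m) (I : Fin m → Fin 2) (k : κ) :
    slotMatrix (A.map Complex.ofRealHom) j I k =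
      MvPolynomial.map Complex.ofRealHom (slotMatrix A j I k) := by
  simp [slotMatrix]

theorem evalForms_map_ofReal (p : κ → MvPolynomial (Fin 2) ℝ) (x : Fin 2 → ℝ) :
    evalForms (fun k => MvPolynomial.map Complex.ofRealHom (p k)) (fun a => (x a : ℂ)) =
      fun k => ((evalForms p x k : ℝ) : ℂ) :=
  funext fun k => by
    simp only [evalForms]
    rw [eval_map]
    exact (MvPolynomial.eval₂_comp Complex.ofRealHom x (p k)).symm

variable [Fintype κ]

theorem IsCurveForm.map_ofReal {A : Matrix (Fin m → Fin 2) κ ℝ} {j : Fin m} {d : ℕ}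
    {p : κ → MvPolynomial (Fin 2) ℝ} (hp : IsCurveForm A j d p) :
    IsCurveForm (A.map Complex.ofRealHom) j d
      fun k => MvPolynomial.map Complex.ofRealHom (p k) where
  homogeneous k := (hp.homogeneous k).map _
  coprime := hp.coprime.map _ hp.homogeneous
  kernel I := by
    simpa [slotMatrix_map] using congrArg (MvPolynomial.map Complex.ofRealHom) (hp.kernel I)

/-- The generic kernels remain lines over `ℂ`. -/
theorem HasGenericKernelLine.map_ofReal {A : Matrix (Fin m → Fin 2) κ ℝ} {j : Fin m}
    (hA : HasGenericKernelLine A j) : HasGenericKernelLine (A.map Complex.ofRealHom) j := by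
  classical
  obtain ⟨d, p, hp⟩ := hA.exists_isCurveForm
  obtain ⟨f, hf, h⟩ := hA
  obtain ⟨x₀, hx₀⟩ : ∃ x, eval x f ≠ 0 := by
    by_contra! h0
    exact hf (MvPolynomial.funext fun x => by simpa using h0 x)
  obtain ⟨z, hz, hzk⟩ := h x₀ hx₀
  -- The square matrix `Mᵀ M + z zᵀ` is invertible at `x₀`, where the kernel of `M` is spanned
  -- by `z`; wherever it is invertible over `ℂ`, the kernel of `M` is at most a line.
  let M : Matrix (Fin m → Fin 2) κ (MvPolynomial (Fin 2) ℝ) := Matrix.of (slotMatrix A j)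
  let N : Matrix κ κ (MvPolynomial (Fin 2) ℝ) :=
    M.transpose * M + Matrix.of fun k l => C (z k * z l)
  have hN : ∀ {K : Type} [Field K] (i : ℝ →+* K) (x : Fin 2 → K) (w : κ → K),
      (N.map (eval₂Hom i x)).mulVec w =
        (M.map (eval₂Hom i x)).transpose.mulVec ((M.map (eval₂Hom i x)).mulVec w) +
          (∑ l, i (z l) * w l) • fun k => i (z k) := by
    intro K _ i x w
    have h1 : N.map (eval₂Hom i x) = (M.map (eval₂Hom i x)).transpose * M.map (eval₂Hom i x) +
        Matrix.of fun k l => i (z k) * i (z l) := by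
      ext k l
      simp [N, Matrix.mul_apply]
    rw [h1, Matrix.add_mulVec, Matrix.mulVec_mulVec]
    congr 1
    funext k
    simp [Matrix.mulVec, dotProduct, Finset.sum_mul]
    exact Finset.sum_congr rfl fun l _ => by ring
  have hdet : N.det ≠ 0 := by
    intro h0
    have h1 : (N.map (eval₂Hom (RingHom.id ℝ) x₀)).det = 0 := by
      rw [← RingHom.mapMatrix_apply, ← RingHom.map_det, h0, map_zero]
    obtain ⟨w, hw, hNw⟩ := Matrix.exists_mulVec_eq_zero_iff.mpr h1
    rw [hN] at hNw
    set Mx := M.map (eval₂Hom (RingHom.id ℝ) x₀) with hMx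
    have h2 : dotProduct (Mx.mulVec w) (Mx.mulVec w) + (∑ l, z l * w l) * (∑ l, z l * w l) = 0 := by
      have := congrArg (dotProduct w) hNw
      rw [dotProduct_add, dotProduct_smul, dotProduct_zero, Matrix.dotProduct_mulVec,
        Matrix.vecMul_transpose] at this
      rw [← this]
      simp [dotProduct, mul_comm]
    have h3 : 0 ≤ dotProduct (Mx.mulVec w) (Mx.mulVec w) :=
      Finset.sum_nonneg fun i _ => mul_self_nonneg _
    have h4 : dotProduct (Mx.mulVec w) (Mx.mulVec w) = 0 := by
      nlinarith [mul_self_nonneg (∑ l, z l * w l)]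
    have h5 : ∑ l, z l * w l = 0 := by
      rw [h4, zero_add] at h2
      exact mul_self_eq_zero.mp h2
    have h6 : ContractsToZero j x₀ (A.mulVec w) := by
      rw [contractsToZero_mulVec_iff]
      exact fun I => congrFun (dotProduct_self_eq_zero.mp h4) I
    obtain ⟨t, rfl⟩ := (hzk w).mp h6
    have h7 : t * ∑ l, z l * z l = 0 := by
      rw [← h5, Finset.mul_sum]
      exact Finset.sum_congr rfl fun l _ => by simp [mul_left_comm]
    rcases mul_eq_zero.mp h7 with rfl | h8
    · exact hw (zero_smul _ _)
    · exact hz (dotProduct_self_eq_zero.mp h8)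
  refine ⟨MvPolynomial.map Complex.ofRealHom N.det * X 0, mul_ne_zero ?_ (X_ne_zero _),
    fun x hx => ?_⟩
  · exact (map_ne_zero_iff _ (MvPolynomial.map_injective _ Complex.ofRealHom.injective)).mpr hdet
  rw [map_mul] at hx
  have hx0 : x ≠ 0 := by
    rintro rfl
    simp at hx
  have hxdet : (N.map (eval₂Hom Complex.ofRealHom x)).det ≠ 0 := by
    rw [← RingHom.mapMatrix_apply, ← RingHom.map_det]
    have := left_ne_zero_of_mul hx
    rwa [eval_map] at this
  have hker : ∀ w : κ → ℂ, ContractsToZero j x ((A.map Complex.ofRealHom).mulVec w) →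
      (N.map (eval₂Hom Complex.ofRealHom x)).mulVec w =
        (∑ l, Complex.ofRealHom (z l) * w l) • fun k => Complex.ofRealHom (z k) := by
    intro w hw
    rw [contractsToZero_mulVec_iff] at hw
    have : (M.map (eval₂Hom Complex.ofRealHom x)).mulVec w = 0 := by
      funext I
      have h1 := hw I
      simp only [slotMatrix_map, eval_map] at h1
      exact h1
    rw [hN, this, Matrix.mulVec_zero, zero_add]
  set P := evalForms (fun k => MvPolynomial.map Complex.ofRealHom (p k)) x with hP
  have hP0 : P ≠ 0 := hp.map_ofReal.evalForms_ne_zero hx0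
  have hPk := hp.map_ofReal.contractsToZero x
  have hs : ∑ l, Complex.ofRealHom (z l) * P l ≠ 0 := by
    intro h0
    refine hxdet (Matrix.exists_mulVec_eq_zero_iff.mp ⟨P, hP0, ?_⟩)
    rw [hker P hPk, h0, zero_smul]
  set s := ∑ l, Complex.ofRealHom (z l) * P l with hsdef
  refine ⟨P, hP0, fun w => ⟨fun hw => ⟨(∑ l, Complex.ofRealHom (z l) * w l) / s, ?_⟩, ?_⟩⟩
  · by_contra hne
    refine hxdet (Matrix.exists_mulVec_eq_zero_iff.mp
      ⟨w - ((∑ l, Complex.ofRealHom (z l) * w l) / s) • P, sub_ne_zero.mpr hne, ?_⟩)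
    rw [Matrix.mulVec_sub, Matrix.mulVec_smul, hker w hw, hker P hPk, ← hsdef, smul_smul,
      div_mul_cancel₀ _ hs, sub_self]
  · rintro ⟨t, rfl⟩
    rw [Matrix.mulVec_smul]
    exact hPk.smul t

end Complexify

/-! ### Curves with the same image -/

section SameImage

variable {m : ℕ} {κ : Type*} [Fintype κ] {A : Matrix (Fin m → Fin 2) κ ℝ} {i j : Fin m} {d e : ℕ}
  {p q : κ → MvPolynomial (Fin 2) ℝ}

/-- The coordinates of the tensors on the curve `p`, as forms in the parameter of the curve. -/
def curveTensor (A : Matrix (Fin m → Fin 2) κ ℝ) (p : κ → MvPolynomial (Fin 2) ℝ)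
    (I : Fin m → Fin 2) : MvPolynomial (Fin 2) ℝ :=
  ∑ k, C (A I k) * p k

theorem curveTensor_isHomogeneous (hp : ∀ k, (p k).IsHomogeneous d) (I : Fin m → Fin 2) :
    (curveTensor A p I).IsHomogeneous d :=
  IsHomogeneous.sum _ _ _ fun k _ => (hp k).C_mul _

theorem eval_curveTensor (x : Fin 2 → ℝ) (I : Fin m → Fin 2) :
    eval x (curveTensor A p I) = A.mulVec (evalForms p x) I := by
  simp [curveTensor, Matrix.mulVec, dotProduct, evalForms]

/-- If the real curve `p` is contained in the image of the `i`-th curve `q`, then the inclusion is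
given by a coprime pair of forms `G`, the kernel of the tensors on `p` in the slot `i`. -/
theorem IsSubcurve.exists_reparametrization (hA : ∀ z, A.mulVec z = 0 → z = 0)
    (hp : IsCurveForm A j d p) (hq : IsCurveForm A i e q) (h : IsSubcurve p q) :
    ∃ (n : ℕ) (G : Fin 2 → MvPolynomial (Fin 2) ℝ), (∀ a, (G a).IsHomogeneous n) ∧
      NoCommonFactor G ∧ (∀ I, ∑ a, G a * curveTensor A p (Function.update I i a) = 0) ∧
      d = n * e ∧ ∃ c : ℝ, c ≠ 0 ∧ ∀ k, p k = C c * bind₁ G (q k) := by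
  obtain ⟨n, G, hGn, hG, hker⟩ := exists_coprime_kernel
    (fun (I : Fin m → Fin 2) (a : Fin 2) => curveTensor A p (Function.update I i a))
    (fun I a => curveTensor_isHomogeneous hp.homogeneous _) (X_ne_zero (0 : Fin 2)) fun x hx => by
      have hx0 : x ≠ 0 := by
        rintro rfl
        simp at hx
      obtain ⟨y, hy, t, -, hpq⟩ := h x hx0
      refine ⟨y, hy, fun I => ?_⟩
      simp only [eval_curveTensor, hpq, Matrix.mulVec_smul]
      rw [← (hq.contractsToZero y).smul t I]
      exact Finset.sum_congr rfl fun a _ => mul_comm _ _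
  have hker' : ∀ I, ∑ a, G a * curveTensor A p (Function.update I i a) = 0 := fun I => by
    rw [← hker I]
    exact Finset.sum_congr rfl fun a _ => mul_comm _ _
  obtain ⟨c, hc, hpc⟩ := (hq.coprime.bind₁ hq.homogeneous hG).exists_eq_C_mul hp.coprime <|
    mul_eq_mul_of_generic (X_ne_zero (0 : Fin 2)) fun x hx => by
      have hx0 : x ≠ 0 := by
        rintro rfl
        simp at hx
      obtain ⟨y, hy, t, ht, hpq⟩ := h x hx0
      have hT : A.mulVec (evalForms p x) ≠ 0 := fun h0 => hp.evalForms_ne_zero hx0 (hA _ h0)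
      have hGx : ContractsToZero i (evalForms G x) (A.mulVec (evalForms p x)) := fun I => by
        have := congrArg (eval x) (hker' I)
        simpa [eval_curveTensor, evalForms] using this
      have hyx : ContractsToZero i y (A.mulVec (evalForms p x)) := by
        rw [hpq, Matrix.mulVec_smul]
        exact (hq.contractsToZero y).smul t
      obtain ⟨s, hs⟩ := hGx.exists_eq_smul hT hyx hy
      refine ⟨evalForms q y, t, s ^ e, hpq, ?_⟩
      rw [← evalForms_smul hq.homogeneous, ← hs]
      exact funext fun k => eval_bind₁ G (q k) x
  exact ⟨n, G, hGn, hG, hker', (hq.coprime.bind₁ hq.homogeneous hG).degree_eq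
    (fun k => isHomogeneous_bind₁ (hq.homogeneous k) hGn) hp.homogeneous hc hpc, c, hc, hpc⟩

/-- If two real curves have the same image, then one is a reparametrization of the other by an
invertible projective transformation, since the degrees of the two reparametrizations multiply
to one. -/
theorem exists_linear_reparametrization (hA : ∀ z, A.mulVec z = 0 → z = 0)
    (hp : IsCurveForm A j d p) (hq : IsCurveForm A i e q) (hpq : IsSubcurve p q)
    (hqp : IsSubcurve q p) : ∃ G : Fin 2 → MvPolynomial (Fin 2) ℝ,
      (∀ a, (G a).IsHomogeneous 1) ∧ NoCommonFactor G ∧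
      ∀ I, ∑ a, G a * curveTensor A p (Function.update I i a) = 0 := by
  obtain ⟨n, G, hGn, hG, hker, hd, -⟩ := hpq.exists_reparametrization hA hp hq
  obtain ⟨n', -, -, -, -, he, -⟩ := hqp.exists_reparametrization hA hq hp
  have hd0 : d ≠ 0 := hp.degree_ne_zero hA
  obtain rfl : n = 1 := by
    rw [he, ← mul_assoc] at hd
    have := (Nat.mul_eq_right hd0).mp hd.symm
    exact Nat.eq_one_of_mul_eq_one_right this
  exact ⟨G, hGn, hG, hker⟩

/-- An inclusion of real curves complexifies, because its reparametrization does. -/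
theorem IsSubcurve.map_ofReal (hA : ∀ z, A.mulVec z = 0 → z = 0)
    (hp : IsCurveForm A j d p) (hq : IsCurveForm A i e q) (h : IsSubcurve p q) :
    IsSubcurve (fun k => MvPolynomial.map Complex.ofRealHom (p k))
      fun k => MvPolynomial.map Complex.ofRealHom (q k) := by
  obtain ⟨n, G, hGn, hG, -, -, c, hc, hpc⟩ := h.exists_reparametrization hA hp hq
  intro x hx
  refine ⟨evalForms (fun a => MvPolynomial.map Complex.ofRealHom (G a)) x, fun h0 => ?_, c,
    by simpa using hc, funext fun k => ?_⟩
  · obtain ⟨a, ha⟩ := (hG.map Complex.ofRealHom hGn).exists_eval_ne_zero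
      (fun a => (hGn a).map _) hx
    exact ha (congrFun h0 a)
  · simp only [evalForms, Pi.smul_apply, hpc, map_mul, map_C, eval_C, map_bind₁, eval_bind₁]
    rfl

theorem mulVec_map_ofReal (z : κ → ℝ) (I : Fin m → Fin 2) :
    (A.map Complex.ofRealHom).mulVec (fun k => (z k : ℂ)) I = (A.mulVec z I : ℝ) := by
  simp [Matrix.mulVec, dotProduct]

/-- An inclusion of the complexifications of two real curves comes from an inclusion of the real
curves: a point of the second curve over a real point of the first one spans the kernel of a
real tensor, hence is real up to a scalar. -/
theorem IsSubcurve.of_map_ofReal (hA : ∀ z, A.mulVec z = 0 → z = 0)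
    (hp : IsCurveForm A j d p) (hq : IsCurveForm A i e q)
    (h : IsSubcurve (fun k => MvPolynomial.map Complex.ofRealHom (p k))
      fun k => MvPolynomial.map Complex.ofRealHom (q k)) : IsSubcurve p q := by
  intro x hx
  have hxc : (fun a => (x a : ℂ)) ≠ 0 := fun h0 => hx (funext fun a => by
    simpa using congrFun h0 a)
  obtain ⟨y, hy, t, ht, hpq⟩ := h _ hxc
  rw [evalForms_map_ofReal] at hpq
  have hyx : ContractsToZero i y fun I => (A.mulVec (evalForms p x) I : ℂ) := by
    have := (hq.map_ofReal.contractsToZero y).smul t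
    rw [← Matrix.mulVec_smul, ← hpq] at this
    intro I
    simpa only [mulVec_map_ofReal] using this I
  have hp0 := hp.evalForms_ne_zero hx
  have hT : (fun I => (A.mulVec (evalForms p x) I : ℂ)) ≠ 0 := fun h0 =>
    hp0 (hA _ (funext fun I => by simpa using congrFun h0 I))
  -- The real and imaginary parts of `y` also contract the real tensor to zero.
  obtain ⟨y', hy'0, hy'⟩ : ∃ y' : Fin 2 → ℝ, y' ≠ 0 ∧
      ContractsToZero i (fun a => (y' a : ℂ)) fun I => (A.mulVec (evalForms p x) I : ℂ) := by
    by_cases hre : (fun a => (y a).re) = 0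
    · refine ⟨fun a => (y a).im, fun him => hy (funext fun a => ?_), fun I => ?_⟩
      · exact Complex.ext (congrFun hre a) (congrFun him a)
      · have := congrArg Complex.im (hyx I)
        simp only [Complex.im_sum, Complex.im_mul_ofReal, Complex.zero_im] at this
        simp only
        exact_mod_cast this
    · refine ⟨fun a => (y a).re, hre, fun I => ?_⟩
      have := congrArg Complex.re (hyx I)
      simp only [Complex.re_sum, Complex.re_mul_ofReal, Complex.zero_re] at this
      simp only
      exact_mod_cast this
  have hy'c : (fun a => (y' a : ℂ)) ≠ 0 := fun h0 => hy'0 (funext fun a => by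
    simpa using congrFun h0 a)
  obtain ⟨s, rfl⟩ := hyx.exists_eq_smul hT hy' hy'c
  rw [evalForms_smul hq.map_ofReal.homogeneous, evalForms_map_ofReal, smul_smul] at hpq
  set u := t * s ^ e
  have hu : ∀ k, ((evalForms p x k : ℝ) : ℂ) = u * ((evalForms q y' k : ℝ) : ℂ) := congrFun hpq
  obtain ⟨k₀, hk₀⟩ := Function.ne_iff.mp (hq.evalForms_ne_zero hy'0)
  have hk₀' : evalForms q y' k₀ ≠ 0 := hk₀
  have hreal : u = ((evalForms p x k₀ / evalForms q y' k₀ : ℝ) : ℂ) := by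
    have : ((evalForms q y' k₀ : ℝ) : ℂ) ≠ 0 := by exact_mod_cast hk₀'
    push_cast
    rw [hu k₀, mul_div_cancel_right₀ _ this]
  have hfin : evalForms p x = (evalForms p x k₀ / evalForms q y' k₀) • evalForms q y' :=
    funext fun k => by
      have := hu k
      rw [hreal] at this
      exact_mod_cast this
  refine ⟨y', hy'0, _, fun h0 => hp0 ?_, hfin⟩
  rw [hfin, h0, zero_smul]

/-- At most `d` curves have the same image as the curve `p` of degree `d`. If there are `d` of
them, then the tensors on `p` are the products of linear pairs `c r` in the corresponding slots
with a constant tensor `ρ`; the pair `c r` is nonzero at every point. -/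
theorem card_le_and_exists_decomposition (hA : ∀ z, A.mulVec z = 0 → z = 0)
    (hp : IsCurveForm A j d p) (S : Finset (Fin m)) {e : Fin m → ℕ}
    {q : Fin m → κ → MvPolynomial (Fin 2) ℝ} (hq : ∀ r, IsCurveForm A r (e r) (q r))
    (hS : ∀ r ∈ S, IsSubcurve p (q r) ∧ IsSubcurve (q r) p) :
    S.card ≤ d ∧ (S.card = d → ∃ (c : Fin m → Fin 2 → MvPolynomial (Fin 2) ℝ)
      (ρ : (Fin m → Fin 2) → ℝ), (∀ r ∈ S, NoCommonFactor (c r)) ∧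
      (∀ r ∈ S, ∀ a, (c r a).IsHomogeneous 1) ∧
      (∀ x I, A.mulVec (evalForms p x) I = (∏ r ∈ S, eval x (c r (I r))) * ρ I) ∧
      ∀ r ∈ S, ∀ I a, ρ (Function.update I r a) = ρ I) := by
  have hG := fun r (hr : r ∈ S) =>
    exists_linear_reparametrization hA hp (hq r) (hS r hr).1 (hS r hr).2
  choose! G hG1 hGc hGk using hG
  let c : Fin m → Fin 2 → MvPolynomial (Fin 2) ℝ := fun r => ![G r 1, -G r 0]
  have hc : ∀ r ∈ S, NoCommonFactor (c r) := fun r hr f hf => hGc r hr f fun a => by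
    fin_cases a
    · exact (dvd_neg.mp (hf 1))
    · exact hf 0
  have hc1 : ∀ r ∈ S, ∀ a, (c r a).IsHomogeneous 1 := fun r hr a => by
    fin_cases a
    · exact hG1 r hr 1
    · exact (hG1 r hr 0).neg
  have hT0 : ∃ I, curveTensor A p I ≠ 0 := by
    by_contra! h0
    have hx : (fun _ => 1 : Fin 2 → ℝ) ≠ 0 := fun h => one_ne_zero (congrFun h 0)
    refine hp.evalForms_ne_zero hx (hA _ (funext fun I => ?_))
    rw [← eval_curveTensor, h0, map_zero, Pi.zero_apply]
  obtain ⟨hle, hconst⟩ := card_le_and_exists_const (curveTensor A p) c S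
    (curveTensor_isHomogeneous hp.homogeneous) hT0 hc hc1 fun r hr I => by
      have := hGk r hr I
      rw [Fin.sum_univ_two] at this
      simp only [c, Matrix.cons_val_zero, Matrix.cons_val_one]
      linear_combination -this
  refine ⟨hle, fun hcard => ?_⟩
  obtain ⟨ρ, hρ, hρS⟩ := hconst hcard
  refine ⟨c, ρ, hc, hc1, fun x I => ?_, hρS⟩
  rw [← eval_curveTensor, hρ, map_mul, map_prod, eval_C]

end SameImage

/-! ### Linear substitutions -/

section LinearSubstitution

variable {F : Type*} [Field F] {σ τ : Type*}

theorem eval_smul_eq_sum (f : MvPolynomial σ F) (t : F) (x : σ → F) :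
    eval (t • x) f = ∑ n ∈ Finset.range (f.totalDegree + 1),
      t ^ n * eval x (homogeneousComponent n f) := by
  conv_lhs => rw [← sum_homogeneousComponent f, map_sum]
  exact Finset.sum_congr rfl fun n _ =>
    eval_smul_of_isHomogeneous (homogeneousComponent_isHomogeneous n f) t x

/-- If a homogeneous component of `f` does not vanish at `x`, then `f` does not vanish at some
nonzero multiple of `x`. -/
theorem exists_eval_smul_ne_zero [Infinite F] {f : MvPolynomial σ F} {n : ℕ} {x : σ → F}
    (h : eval x (homogeneousComponent n f) ≠ 0) : ∃ t : F, t ≠ 0 ∧ eval (t • x) f ≠ 0 := by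
  let q : Polynomial F := ∑ n ∈ Finset.range (f.totalDegree + 1),
    Polynomial.monomial n (eval x (homogeneousComponent n f))
  have hn : n < f.totalDegree + 1 := by
    by_contra hlt
    rw [homogeneousComponent_eq_zero n f (by omega), map_zero] at h
    exact h rfl
  have hq : q ≠ 0 := by
    intro h0
    refine h ?_
    have := congrArg (fun r => Polynomial.coeff r n) h0
    simpa [q, Polynomial.finsetSum_coeff, Polynomial.coeff_monomial, hn] using this
  by_contra! hall
  refine mul_ne_zero Polynomial.X_ne_zero hq (Polynomial.funext fun t => ?_)
  by_cases ht : t = 0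
  · simp [ht]
  · have := hall t ht
    rw [eval_smul_eq_sum] at this
    have h1 : q.eval t = 0 := by
      rw [← this]
      simp [q, Polynomial.eval_finsetSum, mul_comm]
    simp [h1]

variable [Fintype σ] [DecidableEq σ]

/-- The linear forms that give the linear map `E` in coordinates. -/
def linearForms (E : (σ → F) →ₗ[F] (τ → F)) (b : τ) : MvPolynomial σ F :=
  ∑ a, C (E (Pi.single a 1) b) * X a

theorem linearForms_isHomogeneous (E : (σ → F) →ₗ[F] (τ → F)) (b : τ) :
    (linearForms E b).IsHomogeneous 1 :=
  IsHomogeneous.sum _ _ _ fun a _ => (isHomogeneous_X F a).C_mul _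

theorem eval_linearForms (E : (σ → F) →ₗ[F] (τ → F)) (x : σ → F) (b : τ) :
    eval x (linearForms E b) = E x b := by
  conv_rhs => rw [pi_eq_sum_univ' x, map_sum]
  simp [linearForms, Finset.sum_apply, mul_comm]

theorem eval_bind₁_linearForms (E : (σ → F) →ₗ[F] (τ → F)) (f : MvPolynomial τ F) (x : σ → F) :
    eval x (bind₁ (linearForms E) f) = eval (E x) f := by
  rw [eval_bind₁]
  simp only [eval_linearForms]

theorem eval_eq_sum_of_isHomogeneous_one {f : MvPolynomial σ F} (hf : f.IsHomogeneous 1)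
    (x : σ → F) : eval x f = ∑ a, x a * eval (Pi.single a 1) f := by
  have h : f ∈ Submodule.span F (Set.range (X : σ → MvPolynomial σ F)) := by
    rw [← homogeneousSubmodule_one_eq_span_X]
    exact hf
  clear hf
  induction h using Submodule.span_induction with
  | mem f hf =>
    obtain ⟨b, rfl⟩ := hf
    simp [Pi.single_apply]
  | zero => simp
  | add f g _ _ hf hg => simp only [map_add, hf, hg, mul_add, Finset.sum_add_distrib]
  | smul c f _ hf =>
    simp only [smul_eval, hf, Finset.mul_sum, mul_left_comm]

theorem noCommonFactor_linearForms [Infinite F] (E : (Fin 2 → F) ≃ₗ[F] (Fin 2 → F)) :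
    NoCommonFactor (linearForms E.toLinearMap) := by
  refine noCommonFactor_of_X_pow fun a =>
    ⟨1, fun b => C (E.symm (Pi.single b 1) a), MvPolynomial.funext fun x => ?_⟩
  have h := eval_linearForms E.symm.toLinearMap (E x) a
  simp only [LinearEquiv.coe_coe, LinearEquiv.symm_apply_apply] at h
  simp only [map_sum, map_mul, eval_C, eval_linearForms, LinearEquiv.coe_coe, pow_one, eval_X]
  rw [← h]
  simp [linearForms]

end LinearSubstitution

/-! ### Generic conditions and regular maps in fixed coordinates -/

section FixedCoordinates

variable {F : Type*} [Field F] {A B : Type*} [AddCommGroup A] [Module F A]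
  [AddCommGroup B] [Module F B]

/-- A generic condition holds wherever some nonzero polynomial in given coordinates does not
vanish. -/
theorem Generically.exists_polynomial {p : ℙ F A → Prop} (hp : Generically p)
    (b : Basis (Fin 2) F A) : ∃ f : MvPolynomial (Fin 2) F, f ≠ 0 ∧
      ∀ v (hv : v ≠ 0), eval (b.equivFun v) f ≠ 0 → p (Projectivization.mk F v hv) := by
  obtain ⟨U, ⟨n, b', I, -, hU⟩, ⟨ℓ, hℓ⟩, hpU⟩ := hp
  induction ℓ using Projectivization.ind with
  | h v hv =>
    obtain ⟨f, hfI, hfv⟩ := (hU v hv).mp hℓ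
    let E : (Fin 2 → F) →ₗ[F] (Fin n → F) := (b.equivFun.symm.trans b'.equivFun).toLinearMap
    have key : ∀ u, eval (b.equivFun u) (bind₁ (linearForms E) f) = eval (⇑(b'.repr u)) f :=
      fun u => by
        rw [eval_bind₁_linearForms]
        simp [E, Basis.equivFun_apply]
    refine ⟨bind₁ (linearForms E) f, fun h0 => hfv ?_, fun u hu h => hpU _ ?_⟩
    · rw [← key, h0, map_zero]
    · exact (hU u hu).mpr ⟨f, hfI, by rwa [← key]⟩

/-- The converse of `Generically.exists_polynomial`. Since a Zariski-open set is defined by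
homogeneous polynomials, `f` is replaced by one of its homogeneous components: where that does not
vanish, neither does `f` at some other representative of the point. -/
theorem generically_of_polynomial [Infinite F] {p : ℙ F A → Prop} (b : Basis (Fin 2) F A)
    {f : MvPolynomial (Fin 2) F} (hf : f ≠ 0)
    (h : ∀ v (hv : v ≠ 0), eval (b.equivFun v) f ≠ 0 → p (Projectivization.mk F v hv)) :
    Generically p := by
  obtain ⟨n, -, hn⟩ := exists_homogeneousComponent_ne_zero hf
  set g := homogeneousComponent n f with hg
  have hgn : g.IsHomogeneous n := homogeneousComponent_isHomogeneous n f
  have hwd : ∀ v (hv : v ≠ 0) w (hw : w ≠ 0), Projectivization.mk F v hv =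
      Projectivization.mk F w hw → eval (b.equivFun w) g ≠ 0 → eval (b.equivFun v) g ≠ 0 := by
    intro v hv w hw hvw hwg
    obtain ⟨a, rfl⟩ := (Projectivization.mk_eq_mk_iff' F w v hw hv).mp hvw.symm
    rw [map_smul, eval_smul_of_isHomogeneous hgn] at hwg
    exact right_ne_zero_of_mul hwg
  refine ⟨{ℓ | ∃ v, ∃ hv : v ≠ 0, ℓ = Projectivization.mk F v hv ∧ eval (b.equivFun v) g ≠ 0},
    ⟨2, b, {g}, fun f hf => ⟨n, by rw [hf]; exact hgn⟩, fun v hv => ?_⟩, ?_, ?_⟩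
  · simp only [Set.mem_ofPred_eq, Set.mem_singleton_iff, exists_eq_left]
    constructor
    · rintro ⟨w, hw, hvw, hwg⟩
      exact hwd v hv w hw hvw hwg
    · exact fun hvg => ⟨v, hv, rfl, hvg⟩
  · have hgX : g * X 0 ≠ 0 := mul_ne_zero hn (X_ne_zero _)
    obtain ⟨x, hx⟩ : ∃ x, eval x (g * X 0) ≠ 0 := by
      by_contra! h0
      exact hgX (MvPolynomial.funext fun x => by simpa using h0 x)
    rw [map_mul, eval_X] at hx
    refine ⟨_, b.equivFun.symm x, fun h0 => ?_, rfl, ?_⟩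
    · rw [LinearEquiv.map_eq_zero_iff] at h0
      simp [h0] at hx
    · rw [LinearEquiv.apply_symm_apply]
      exact left_ne_zero_of_mul hx
  · rintro _ ⟨v, hv, rfl, hvg⟩
    obtain ⟨t, ht, htf⟩ := exists_eval_smul_ne_zero hvg
    have htv : t • v ≠ 0 := smul_ne_zero ht hv
    have := h (t • v) htv (by rwa [map_smul])
    rwa [(Projectivization.mk_eq_mk_iff' F v (t • v) hv htv).mpr ⟨t⁻¹, inv_smul_smul₀ ht v⟩]

/-- A regular map is given by coprime forms of its degree in any coordinates. -/
theorem IsRegularOfDegree.exists_forms [Infinite F] {ψ : ℙ F A → ℙ F B} {d : ℕ}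
    (h : IsRegularOfDegree ψ d) (b : Basis (Fin 2) F A) {κ : Type*} [Fintype κ]
    (c : Basis κ F B) : ∃ p : κ → MvPolynomial (Fin 2) F, (∀ k, (p k).IsHomogeneous d) ∧
      NoCommonFactor p ∧ ∀ v (hv : v ≠ 0), (ψ (Projectivization.mk F v hv)).submodule =
        F ∙ c.equivFun.symm (evalForms p (b.equivFun v)) := by
  classical
  obtain ⟨n, b', c', f, hfd, hf, hψ⟩ := h
  let E : (Fin 2 → F) ≃ₗ[F] (Fin 2 → F) := b.equivFun.symm.trans b'.equivFun
  let M : (Fin n → F) ≃ₗ[F] (κ → F) := c'.equivFun.symm.trans c.equivFun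
  let g : Fin n → MvPolynomial (Fin 2) F := fun i => bind₁ (linearForms E.toLinearMap) (f i)
  have hg : NoCommonFactor g :=
    NoCommonFactor.bind₁ hf hfd (noCommonFactor_linearForms E)
  have hgd : ∀ i, (g i).IsHomogeneous d := fun i => by
    simpa using isHomogeneous_bind₁ (hfd i) (linearForms_isHomogeneous E.toLinearMap)
  let p : κ → MvPolynomial (Fin 2) F := fun k => ∑ i, C (M (Pi.single i 1) k) * g i
  have hp : ∀ x, evalForms p x = M (evalForms g x) := fun x => funext fun k => by
    rw [← LinearEquiv.coe_coe, ← eval_linearForms M.toLinearMap (evalForms g x) k]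
    simp [p, linearForms, evalForms]
  refine ⟨p, fun k => IsHomogeneous.sum _ _ _ fun i _ => (hgd i).C_mul _, fun q hq => ?_, ?_⟩
  · refine hg q fun i => ?_
    have : g i = ∑ k, C (M.symm (Pi.single k 1) i) * p k := by
      refine MvPolynomial.funext fun x => ?_
      have h1 := eval_linearForms M.symm.toLinearMap (evalForms p x) i
      rw [LinearEquiv.coe_coe, hp, LinearEquiv.symm_apply_apply] at h1
      rw [show eval x (g i) = evalForms g x i from rfl, ← h1, ← hp]
      simp [linearForms, evalForms]
    rw [this]
    exact Finset.dvd_sum fun k _ => (hq k).mul_left _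
  · intro v hv
    rw [hψ v hv, hp]
    congr 2
    have : evalForms g (b.equivFun v) = fun i => eval (⇑(b'.repr v)) (f i) := funext fun i => by
      simp [evalForms, g, eval_bind₁_linearForms, E, Basis.equivFun_apply]
    rw [this]
    simp [M, Basis.equivFun_symm_apply]

end FixedCoordinates

/-! ### Coordinates of tensors -/

section TensorCoordinates

variable {F : Type*} [Field F] {ι : Type*} [Fintype ι] {V : ι → Type*} [∀ r, AddCommGroup (V r)]
  [∀ r, Module F (V r)]

/-- The coordinates of a tensor in `⨂ V_r^*` with respect to bases of the `V_r`: its values at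
the basis vectors of `⨂ V_r`. -/
def tensorCoord (b : ∀ r, Basis (Fin 2) F (V r)) :
    (⨂[F] r, Dual F (V r)) →ₗ[F] ((ι → Fin 2) → F) :=
  LinearMap.pi fun I => (LinearMap.applyₗ (PiTensorProduct.tprod F fun r => b r (I r))).comp
    PiTensorProduct.dualDistrib

theorem tensorCoord_apply (b : ∀ r, Basis (Fin 2) F (V r)) (t : ⨂[F] r, Dual F (V r))
    (I : ι → Fin 2) : tensorCoord b t I =
      PiTensorProduct.dualDistrib t (PiTensorProduct.tprod F fun r => b r (I r)) := rfl

theorem tensorCoord_bijective (b : ∀ r, Basis (Fin 2) F (V r)) :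
    Function.Bijective (tensorCoord b) := by
  constructor
  · intro s t h
    refine (PiTensorProduct.dualDistribEquivOfBasis b).injective ?_
    refine (Basis.piTensorProduct b).ext fun I => ?_
    rw [Basis.piTensorProduct_apply]
    exact congrFun h I
  · intro T
    refine ⟨(PiTensorProduct.dualDistribEquivOfBasis b).symm
      ((Basis.piTensorProduct b).constr F T), funext fun I => ?_⟩
    have h := (PiTensorProduct.dualDistribEquivOfBasis b).apply_symm_apply
      ((Basis.piTensorProduct b).constr F T)
    have h' : PiTensorProduct.dualDistrib ((PiTensorProduct.dualDistribEquivOfBasis b).symm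
      ((Basis.piTensorProduct b).constr F T)) = (Basis.piTensorProduct b).constr F T := h
    rw [tensorCoord_apply, h', ← Basis.piTensorProduct_apply, Basis.constr_basis]

end TensorCoordinates

section CurveCoordinates

variable {F : Type*} [Field F] {m : ℕ} {V : Fin m → Type*} [∀ r, AddCommGroup (V r)]
  [∀ r, Module F (V r)] {H : Type*} [AddCommGroup H] [Module F H]

theorem mem_slotAnnihilator_iff {j : Fin m} {v : V j} (hv : v ≠ 0) {t : ⨂[F] r, Dual F (V r)} :
    t ∈ slotAnnihilator j (Projectivization.mk F v hv) ↔ ∀ u : ∀ r, V r,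
      PiTensorProduct.dualDistrib t (PiTensorProduct.tprod F (Function.update u j v)) = 0 := by
  rw [slotAnnihilator, Submodule.mem_comap, Submodule.mem_dualAnnihilator]
  constructor
  · intro h u
    refine h _ (Submodule.subset_span ⟨_, ?_, rfl⟩)
    rw [Function.update_self, Projectivization.submodule_mk]
    exact Submodule.mem_span_singleton_self v
  · intro h w hw
    induction hw using Submodule.span_induction with
    | mem w hw =>
      obtain ⟨u, hu, rfl⟩ := hw
      rw [Projectivization.submodule_mk] at hu
      obtain ⟨s, hs⟩ := Submodule.mem_span_singleton.mp hu
      have := h u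
      rw [← Function.update_eq_self j u, ← hs, MultilinearMap.map_update_smul, map_smul, this,
        smul_zero]
    | zero => simp
    | add x y _ _ hx hy => rw [map_add, hx, hy, add_zero]
    | smul c x _ hx => rw [map_smul, hx, smul_zero]

/-- In coordinates, `Σ⁰_{j,ℓ}` consists of the tensors that contract to zero with `ℓ` in the
slot `j`. -/
theorem mem_slotAnnihilator_iff_contractsToZero (b : ∀ r, Basis (Fin 2) F (V r)) {j : Fin m}
    {v : V j} (hv : v ≠ 0) {t : ⨂[F] r, Dual F (V r)} :
    t ∈ slotAnnihilator j (Projectivization.mk F v hv) ↔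
      ContractsToZero j ((b j).equivFun v) (tensorCoord b t) := by
  rw [mem_slotAnnihilator_iff]
  let f : MultilinearMap F V F :=
    (PiTensorProduct.dualDistrib t).compMultilinearMap (PiTensorProduct.tprod F)
  have hup : ∀ (I : Fin m → Fin 2) (a : Fin 2), (fun r => b r (Function.update I j a r)) =
      Function.update (fun r => b r (I r)) j (b j a) := fun I a => by
    funext r
    by_cases hr : r = j
    · subst hr; simp
    · simp [hr]
  have hsum : ∀ I : Fin m → Fin 2, f (Function.update (fun r => b r (I r)) j v) =
      ∑ a, (b j).equivFun v a * tensorCoord b t (Function.update I j a) := fun I => by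
    conv_lhs => rw [← (b j).sum_equivFun v]
    rw [MultilinearMap.map_update_sum]
    refine Finset.sum_congr rfl fun a _ => ?_
    rw [MultilinearMap.map_update_smul, smul_eq_mul, tensorCoord_apply, hup]
    rfl
  constructor
  · intro h I
    rw [← hsum]
    exact h _
  · intro h u
    -- Precomposing the slot `j` with a map that sends all basis vectors to `v` gives a
    -- multilinear map that vanishes on basis vectors.
    let P : ∀ r, V r →ₗ[F] V r := Function.update (fun r => LinearMap.id) j
      ((b j).constr F fun _ => v)
    have hPj : ∀ a, P j (b j a) = v := fun a => by simp [P]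
    have hP : ∀ r, r ≠ j → P r = LinearMap.id := fun r hr => by simp [P, hr]
    have hg : f.compLinearMap P = 0 := by
      refine Basis.ext_multilinear b fun I => ?_
      rw [MultilinearMap.compLinearMap_apply, zero_apply]
      have := h I
      rw [← hsum] at this
      rw [← this]
      congr 1
      funext r
      by_cases hr : r = j
      · subst hr; simp [hPj]
      · simp [hr, hP]
    have := congrArg (fun g => g (Function.update u j (b j 0))) hg
    simp only [MultilinearMap.compLinearMap_apply, zero_apply] at this
    change f _ = 0
    rw [← this]
    congr 1
    funext r
    by_cases hr : r = j
    · subst hr; simp [hPj]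
    · simp [hr, hP]

theorem comap_range_inf_slotAnnihilator (φ : H →ₗ[F] ⨂[F] r, Dual F (V r)) {j : Fin m}
    (ℓ : ℙ F (V j)) :
    (LinearMap.range φ ⊓ slotAnnihilator j ℓ).comap φ = (slotAnnihilator j ℓ).comap φ := by
  ext h
  simp

/-- The matrix of `φ` in coordinates. -/
def coordMatrix {κ : Type*} (φ : H →ₗ[F] ⨂[F] r, Dual F (V r)) (b : ∀ r, Basis (Fin 2) F (V r))
    (c : Basis κ F H) : Matrix (Fin m → Fin 2) κ F :=
  Matrix.of fun I k => tensorCoord b (φ (c k)) I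

variable {κ : Type*} [Fintype κ] {φ : H →ₗ[F] ⨂[F] r, Dual F (V r)}
  {b : ∀ r, Basis (Fin 2) F (V r)} {c : Basis κ F H}

theorem tensorCoord_map (z : κ → F) :
    tensorCoord b (φ (c.equivFun.symm z)) = (coordMatrix φ b c).mulVec z := by
  funext I
  simp [Basis.equivFun_symm_apply, coordMatrix, Matrix.mulVec, dotProduct, Finset.sum_apply,
    mul_comm]

theorem coordMatrix_injective (hφ : Function.Injective φ) (z : κ → F)
    (hz : (coordMatrix φ b c).mulVec z = 0) : z = 0 := by
  rw [← tensorCoord_map, ← map_zero (tensorCoord b)] at hz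
  have := (tensorCoord_bijective b).1 hz
  rw [← map_zero φ] at this
  exact (LinearEquiv.map_eq_zero_iff _).mp (hφ this)

theorem map_mem_slotAnnihilator_iff {j : Fin m} {v : V j} (hv : v ≠ 0) (z : κ → F) :
    φ (c.equivFun.symm z) ∈ slotAnnihilator j (Projectivization.mk F v hv) ↔
      ContractsToZero j ((b j).equivFun v) ((coordMatrix φ b c).mulVec z) := by
  rw [mem_slotAnnihilator_iff_contractsToZero b, tensorCoord_map]

theorem IsFactorizationStructure.hasGenericKernelLine (hφ : IsFactorizationStructure φ)
    (j : Fin m) : HasGenericKernelLine (coordMatrix φ b c) j := by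
  obtain ⟨f, hf, h⟩ := (hφ.generic j).exists_polynomial (b j)
  refine ⟨f * X 0, mul_ne_zero hf (X_ne_zero _), fun x hx => ?_⟩
  rw [map_mul, eval_X] at hx
  have hx0 : x ≠ 0 := by
    rintro rfl
    simp at hx
  have hv : (b j).equivFun.symm x ≠ 0 :=
    (LinearEquiv.map_ne_zero_iff _).mpr hx0
  have h1 := h _ hv (by rw [LinearEquiv.apply_symm_apply]; exact left_ne_zero_of_mul hx)
  -- The one-dimensional intersection is pulled back to a line in `H`.
  let K := (LinearMap.range φ ⊓ slotAnnihilator j (Projectivization.mk F _ hv)).comap φ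
  have hK : K.map φ = LinearMap.range φ ⊓ slotAnnihilator j (Projectivization.mk F _ hv) :=
    Submodule.map_comap_eq_self inf_le_left
  have h2 : finrank F K = 1 := by
    rw [← h1, ← hK]
    exact (Submodule.equivMapOfInjective φ hφ.injective K).finrank_eq
  obtain ⟨⟨w, hw⟩, hw0, hspan⟩ := finrank_eq_one_iff'.mp h2
  obtain ⟨z, rfl⟩ := c.equivFun.symm.surjective w
  have hmem : ∀ y, c.equivFun.symm y ∈ K ↔ ContractsToZero j x ((coordMatrix φ b c).mulVec y) := by
    intro y
    have := map_mem_slotAnnihilator_iff (φ := φ) (b := b) (c := c) hv y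
    rw [LinearEquiv.apply_symm_apply] at this
    rw [← this]
    exact ⟨fun hy => hy.2, fun hy => ⟨⟨_, rfl⟩, hy⟩⟩
  refine ⟨z, ?_, fun y => ?_⟩
  · rintro rfl
    exact hw0 (Subtype.ext (map_zero _))
  · rw [← hmem]
    constructor
    · intro hy
      obtain ⟨t, ht⟩ := hspan ⟨_, hy⟩
      have ht' : t • c.equivFun.symm z = c.equivFun.symm y := congrArg Subtype.val ht
      rw [← map_smul] at ht'
      exact ⟨t, (c.equivFun.symm.injective ht').symm⟩
    · rintro ⟨t, rfl⟩
      rw [map_smul]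
      exact Submodule.smul_mem _ _ hw

end CurveCoordinates

/-! ### The factorization curve and its degree -/

section FactorizationCurve

variable {F : Type*} [Field F] [Infinite F] {m : ℕ} {V : Fin m → Type*}
  [∀ r, AddCommGroup (V r)] [∀ r, Module F (V r)] {H : Type*} [AddCommGroup H] [Module F H]
  {φ : H →ₗ[F] ⨂[F] r, Dual F (V r)} {n : ℕ} {b : ∀ r, Basis (Fin 2) F (V r)}
  {c : Basis (Fin n) F H} {i j : Fin m} {d e : ℕ} {p q : Fin n → MvPolynomial (Fin 2) F}

theorem exists_isFactorizationCurve (hA : HasGenericKernelLine (coordMatrix φ b c) j)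
    (hp : IsCurveForm (coordMatrix φ b c) j d p) : ∃ ψ, IsFactorizationCurve φ j ψ := by
  have hval : ∀ v : V j, v ≠ 0 → c.equivFun.symm (evalForms p ((b j).equivFun v)) ≠ 0 :=
    fun v hv => (LinearEquiv.map_ne_zero_iff _).mpr
      (hp.evalForms_ne_zero ((LinearEquiv.map_ne_zero_iff _).mpr hv))
  let ψ : ℙ F (V j) → ℙ F H := fun ℓ => Projectivization.mk F _ (hval ℓ.rep ℓ.rep_nonzero)
  have hψ : ∀ v (hv : v ≠ 0), (ψ (Projectivization.mk F v hv)).submodule =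
      F ∙ c.equivFun.symm (evalForms p ((b j).equivFun v)) := fun v hv => by
    obtain ⟨a, ha⟩ := Projectivization.exists_smul_eq_mk_rep F v hv
    rw [Projectivization.submodule_mk, ← ha, Units.smul_def, map_smul,
      evalForms_smul hp.homogeneous, map_smul]
    exact Submodule.span_singleton_smul_eq ((a.isUnit).pow d) _
  refine ⟨ψ, ⟨d, n, b j, c, p, hp.homogeneous, hp.coprime, fun v hv => ?_⟩, ?_⟩
  · rw [hψ, Basis.equivFun_symm_apply]
    rfl
  · obtain ⟨f, hf, hz⟩ := hA
    refine generically_of_polynomial (b j) hf fun v hv hfv => ?_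
    rw [hψ, comap_range_inf_slotAnnihilator]
    obtain ⟨z, -, hzk⟩ := hz _ hfv
    obtain ⟨t, ht⟩ := (hzk _).mp (hp.contractsToZero _)
    have ht0 : t ≠ 0 := by
      rintro rfl
      rw [zero_smul] at ht
      exact hp.evalForms_ne_zero ((LinearEquiv.map_ne_zero_iff _).mpr hv) ht
    ext h
    obtain ⟨y, rfl⟩ := c.equivFun.symm.surjective h
    rw [Submodule.mem_comap, map_mem_slotAnnihilator_iff (b := b), hzk, ht,
      Submodule.mem_span_singleton]
    constructor
    · rintro ⟨s, hs⟩
      rw [← map_smul] at hs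
      exact ⟨s * t, by rw [mul_smul, c.equivFun.symm.injective hs]⟩
    · rintro ⟨s, rfl⟩
      exact ⟨s * t⁻¹, by rw [← map_smul, smul_smul, inv_mul_cancel_right₀ ht0]⟩

/-- A regular extension of the generic kernels has the degree of the coprime forms `p` that lie
in the kernels, and is given by them. -/
theorem IsFactorizationCurve.degree_eq_and_submodule_eq {ψ : ℙ F (V j) → ℙ F H}
    (hψ : IsFactorizationCurve φ j ψ) (hA : HasGenericKernelLine (coordMatrix φ b c) j)
    (hp : IsCurveForm (coordMatrix φ b c) j d p) (he : IsRegularOfDegree ψ e) :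
    e = d ∧ ∀ v (hv : v ≠ 0), (ψ (Projectivization.mk F v hv)).submodule =
      F ∙ c.equivFun.symm (evalForms p ((b j).equivFun v)) := by
  obtain ⟨q, hqd, hq, hψq⟩ := he.exists_forms (b j) c
  obtain ⟨f, hf, hgen⟩ := hψ.2.exists_polynomial (b j)
  obtain ⟨hde, t, ht, hqp⟩ := hp.unique hA hq hqd (mul_ne_zero hf (X_ne_zero 0)) fun x hx => by
    rw [map_mul, eval_X] at hx
    have hx0 : x ≠ 0 := by
      rintro rfl
      simp at hx
    have hv : (b j).equivFun.symm x ≠ 0 := (LinearEquiv.map_ne_zero_iff _).mpr hx0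
    have h := hgen _ hv (by rw [LinearEquiv.apply_symm_apply]; exact left_ne_zero_of_mul hx)
    rw [hψq, comap_range_inf_slotAnnihilator, LinearEquiv.apply_symm_apply] at h
    have hmem := h ▸ Submodule.mem_span_singleton_self (R := F)
      (c.equivFun.symm (evalForms q x))
    rwa [Submodule.mem_comap, map_mem_slotAnnihilator_iff (b := b),
      LinearEquiv.apply_symm_apply] at hmem
  refine ⟨hde, fun v hv => ?_⟩
  rw [hψq, hqp, map_smul]
  exact Submodule.span_singleton_smul_eq ht.isUnit _

variable [Nontrivial H]

theorem isFactorizationCurve_factorizationCurve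
    (hA : HasGenericKernelLine (coordMatrix φ b c) j)
    (hp : IsCurveForm (coordMatrix φ b c) j d p) :
    IsFactorizationCurve φ j (factorizationCurve φ j) :=
  Classical.epsilon_spec (exists_isFactorizationCurve hA hp)

theorem submodule_factorizationCurve (hA : HasGenericKernelLine (coordMatrix φ b c) j)
    (hp : IsCurveForm (coordMatrix φ b c) j d p) {v : V j} (hv : v ≠ 0) :
    (factorizationCurve φ j (Projectivization.mk F v hv)).submodule =
      F ∙ c.equivFun.symm (evalForms p ((b j).equivFun v)) := by
  have h := isFactorizationCurve_factorizationCurve hA hp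
  obtain ⟨e, he⟩ := h.1
  exact (h.degree_eq_and_submodule_eq hA hp he).2 v hv

theorem degree_factorizationCurve (hA : HasGenericKernelLine (coordMatrix φ b c) j)
    (hp : IsCurveForm (coordMatrix φ b c) j d p) : degree (factorizationCurve φ j) = d := by
  have h := isFactorizationCurve_factorizationCurve hA hp
  obtain ⟨e, he⟩ := h.1
  have hset : {d' | IsRegularOfDegree (factorizationCurve φ j) d'} = {d} := by
    ext d'
    constructor
    · exact fun hd' => (h.degree_eq_and_submodule_eq hA hp hd').1
    · rintro rfl
      exact (h.degree_eq_and_submodule_eq hA hp he).1 ▸ he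
  rw [degree, hset, csInf_singleton]

theorem range_factorizationCurve_subset_iff (hAi : HasGenericKernelLine (coordMatrix φ b c) i)
    (hp : IsCurveForm (coordMatrix φ b c) i d p) (hAj : HasGenericKernelLine (coordMatrix φ b c) j)
    (hq : IsCurveForm (coordMatrix φ b c) j e q) :
    Set.range (factorizationCurve φ i) ⊆ Set.range (factorizationCurve φ j) ↔ IsSubcurve p q := by
  have key : ∀ v (hv : v ≠ 0) w (hw : w ≠ 0),
      factorizationCurve φ i (Projectivization.mk F v hv) =
        factorizationCurve φ j (Projectivization.mk F w hw) ↔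
      ∃ t : F, t ≠ 0 ∧
        evalForms p ((b i).equivFun v) = t • evalForms q ((b j).equivFun w) := by
    intro v hv w hw
    rw [← (Projectivization.submodule_injective).eq_iff, submodule_factorizationCurve hAi hp,
      submodule_factorizationCurve hAj hq, eq_comm, Submodule.span_singleton_eq_span_singleton]
    constructor
    · rintro ⟨t, ht⟩
      refine ⟨t, t.ne_zero, c.equivFun.symm.injective ?_⟩
      rw [map_smul, ← ht]
      rfl
    · rintro ⟨t, ht, h⟩
      refine ⟨Units.mk0 t ht, ?_⟩
      rw [h, map_smul]
      rfl
  constructor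
  · intro h x hx
    have hv : (b i).equivFun.symm x ≠ 0 := (LinearEquiv.map_ne_zero_iff _).mpr hx
    obtain ⟨ℓ, hℓ⟩ := h ⟨Projectivization.mk F _ hv, rfl⟩
    induction ℓ using Projectivization.ind with
    | h w hw =>
      obtain ⟨t, ht, h⟩ := (key _ hv w hw).mp hℓ.symm
      rw [LinearEquiv.apply_symm_apply] at h
      exact ⟨_, (LinearEquiv.map_ne_zero_iff _).mpr hw, t, ht, h⟩
  · rintro h _ ⟨ℓ, rfl⟩
    induction ℓ using Projectivization.ind with
    | h v hv =>
      obtain ⟨y, hy, t, ht, h⟩ := h _ ((LinearEquiv.map_ne_zero_iff (b i).equivFun).mpr hv)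
      have hw : (b j).equivFun.symm y ≠ 0 := (LinearEquiv.map_ne_zero_iff _).mpr hy
      refine ⟨Projectivization.mk F _ hw, ((key v hv _ hw).mpr ⟨t, ht, ?_⟩).symm⟩
      rwa [LinearEquiv.apply_symm_apply]

theorem equivalent_iff_isSubcurve (hAi : HasGenericKernelLine (coordMatrix φ b c) i)
    (hp : IsCurveForm (coordMatrix φ b c) i d p) (hAj : HasGenericKernelLine (coordMatrix φ b c) j)
    (hq : IsCurveForm (coordMatrix φ b c) j e q) :
    Equivalent φ i j ↔ IsSubcurve p q ∧ IsSubcurve q p := by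
  rw [Equivalent, Set.Subset.antisymm_iff, range_factorizationCurve_subset_iff hAi hp hAj hq,
    range_factorizationCurve_subset_iff hAj hq hAi hp]

end FactorizationCurve

/-! ### The complexified factorization structure -/

section Complexified

variable {m : ℕ} {V : Fin m → Type*} [∀ r, AddCommGroup (V r)] [∀ r, Module ℝ (V r)]
  {H : Type*} [AddCommGroup H] [Module ℝ H] {φ : H →ₗ[ℝ] ⨂[ℝ] r, Dual ℝ (V r)}
  {b : ∀ r, Basis (Fin 2) ℝ (V r)}

theorem tensorCoord_tensorComplexify (t : ⨂[ℝ] r, Dual ℝ (V r)) (I : Fin m → Fin 2) :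
    tensorCoord (fun r => (b r).baseChange ℂ) (tensorComplexify t) I = (tensorCoord b t I : ℂ) := by
  induction t using PiTensorProduct.induction_on with
  | smul_tprod s f =>
    have h : tensorComplexify (s • PiTensorProduct.tprod ℝ f) =
        (s : ℂ) • PiTensorProduct.tprod ℂ fun r => Module.Dual.baseChange ℂ (f r) := by
      rw [map_smul, tensorComplexify, PiTensorProduct.lift.tprod]
      exact (algebraMap_smul ℂ s _).symm
    rw [h, map_smul, map_smul, Pi.smul_apply, Pi.smul_apply, tensorCoord_apply, tensorCoord_apply,
      PiTensorProduct.dualDistrib_apply, PiTensorProduct.dualDistrib_apply]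
    simp [Basis.baseChange_apply]
  | add x y hx hy =>
    simp only [map_add, Pi.add_apply, hx, hy, Complex.ofReal_add]

theorem coordMatrix_complexification {κ : Type*} (c : Basis κ ℝ H) :
    coordMatrix (complexification φ) (fun r => (b r).baseChange ℂ) (c.baseChange ℂ) =
      (coordMatrix φ b c).map Complex.ofRealHom := by
  ext I k
  simp only [coordMatrix, Matrix.of_apply, Matrix.map_apply, Complex.ofRealHom_eq_coe,
    Basis.baseChange_apply]
  rw [← tensorCoord_tensorComplexify]
  simp [complexification]

/-- The curves of a real factorization structure and of its complexification have the same degrees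
and the same equivalences. -/
theorem decomposable_iff_complexification [Nontrivial H] (hφ : IsFactorizationStructure φ)
    (b : ∀ r, Basis (Fin 2) ℝ (V r)) {n : ℕ} (c : Basis (Fin n) ℝ H) (j : Fin m) :
    IsDecomposable φ j ↔ IsDecomposable (complexification φ) j := by
  have hA := hφ.hasGenericKernelLine (b := b) (c := c)
  have hinj := coordMatrix_injective (b := b) (c := c) hφ.injective
  choose d p hp using fun i => (hA i).exists_isCurveForm
  have hAc : ∀ i, HasGenericKernelLine (coordMatrix (complexification φ)
      (fun r => (b r).baseChange ℂ) (c.baseChange ℂ)) i := fun i => by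
    rw [coordMatrix_complexification]
    exact (hA i).map_ofReal
  have hpc : ∀ i, IsCurveForm (coordMatrix (complexification φ)
      (fun r => (b r).baseChange ℂ) (c.baseChange ℂ)) i (d i)
      fun k => MvPolynomial.map Complex.ofRealHom (p i k) := fun i => by
    rw [coordMatrix_complexification]
    exact (hp i).map_ofReal
  have heq : ∀ i, Equivalent φ i j ↔ Equivalent (complexification φ) i j := fun i => by
    rw [equivalent_iff_isSubcurve (hA i) (hp i) (hA j) (hp j),
      equivalent_iff_isSubcurve (hAc i) (hpc i) (hAc j) (hpc j)]
    exact and_congr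
      ⟨fun h => h.map_ofReal hinj (hp i) (hp j), fun h => h.of_map_ofReal hinj (hp i) (hp j)⟩
      ⟨fun h => h.map_ofReal hinj (hp j) (hp i), fun h => h.of_map_ofReal hinj (hp j) (hp i)⟩
  rw [IsDecomposable, IsDecomposable, degree_factorizationCurve (hA j) (hp j),
    degree_factorizationCurve (hAc j) (hpc j)]
  simp only [heq]

end Complexified

/-! ### Filling slots of a tensor -/

section FillSlots

variable {F : Type*} [Field F] {m : ℕ} {V : Fin m → Type*} [∀ r, AddCommGroup (V r)]
  [∀ r, Module F (V r)]

theorem dualDistrib_fillSlots (S : Finset (Fin m)) (a : ∀ r, Dual F (V r))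
    (t : ⨂[F] r : {r : Fin m // r ∉ S}, Dual F (V r)) (u : ∀ r, V r) :
    PiTensorProduct.dualDistrib (fillSlots S a t) (PiTensorProduct.tprod F u) =
      (∏ r ∈ S, a r (u r)) * PiTensorProduct.dualDistrib t
        (PiTensorProduct.tprod F fun r : {r : Fin m // r ∉ S} => u r) := by
  classical
  induction t using PiTensorProduct.induction_on with
  | smul_tprod s f =>
    have h : fillSlots S a (PiTensorProduct.tprod F f) = PiTensorProduct.tprod F
        fun r => if h : r ∉ S then f ⟨r, h⟩ else a r := by
      rw [fillSlots, PiTensorProduct.lift.tprod, MultilinearMap.domDomRestrict_apply]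
    rw [map_smul, map_smul, map_smul, LinearMap.smul_apply, LinearMap.smul_apply, h,
      PiTensorProduct.dualDistrib_apply, PiTensorProduct.dualDistrib_apply,
      ← Finset.prod_mul_prod_compl S, smul_eq_mul, smul_eq_mul, mul_left_comm]
    congr 1
    · refine Finset.prod_congr rfl fun r hr => ?_
      simp [hr]
    · congr 1
      rw [Finset.prod_subtype Sᶜ (p := fun r => r ∉ S) fun r => Finset.mem_compl]
      refine Finset.prod_congr rfl ?_
      rintro ⟨r, hr⟩ -
      simp [hr]
  | add x y hx hy =>
    rw [map_add, map_add, map_add, LinearMap.add_apply, LinearMap.add_apply, hx, hy, mul_add]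

theorem tensorCoord_fillSlots (b : ∀ r, Basis (Fin 2) F (V r)) (S : Finset (Fin m))
    (a : ∀ r, Dual F (V r)) (t : ⨂[F] r : {r : Fin m // r ∉ S}, Dual F (V r))
    (I : Fin m → Fin 2) : tensorCoord b (fillSlots S a t) I = (∏ r ∈ S, a r (b r (I r))) *
      tensorCoord (fun r : {r : Fin m // r ∉ S} => b r) t fun r => I r :=
  dualDistrib_fillSlots S a t _

/-- The product of lines in the slots in `S` with a line in the remaining slots is a line. -/
theorem slotProduct_span_singleton (b : ∀ r, Basis (Fin 2) F (V r)) (S : Finset (Fin m))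
    (a : ∀ r, Dual F (V r)) (t : ⨂[F] r : {r : Fin m // r ∉ S}, Dual F (V r)) :
    slotProduct S (fun r _ => F ∙ a r) (F ∙ t) = F ∙ fillSlots S a t := by
  refine le_antisymm (Submodule.span_le.mpr ?_) (Submodule.span_le.mpr ?_)
  · rintro _ ⟨a', ha', _, ht', rfl⟩
    obtain ⟨s, rfl⟩ := Submodule.mem_span_singleton.mp ht'
    have h : ∀ r, ∃ s : F, r ∈ S → s • a r = a' r := fun r => by
      by_cases hr : r ∈ S
      · obtain ⟨s, hs⟩ := Submodule.mem_span_singleton.mp (ha' r hr)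
        exact ⟨s, fun _ => hs⟩
      · exact ⟨0, fun h => absurd h hr⟩
    choose σ hσ using h
    refine Submodule.mem_span_singleton.mpr ⟨s * ∏ r ∈ S, σ r, ?_⟩
    refine (tensorCoord_bijective b).1 (funext fun I => ?_)
    have hprod : ∏ r ∈ S, a' r (b r (I r)) = (∏ r ∈ S, σ r) * ∏ r ∈ S, a r (b r (I r)) := by
      rw [← Finset.prod_mul_distrib]
      refine Finset.prod_congr rfl fun r hr => ?_
      rw [← hσ r hr]
      rfl
    simp only [map_smul, Pi.smul_apply, tensorCoord_fillSlots, hprod, smul_eq_mul]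
    ring
  · rintro _ rfl
    exact Submodule.subset_span ⟨a, fun r _ => Submodule.mem_span_singleton_self _, t,
      Submodule.mem_span_singleton_self _, rfl⟩

theorem slotProduct_congr {S : Finset (Fin m)} {L L' : ∀ r ∈ S, Submodule F (Dual F (V r))}
    {Γ : Submodule F (⨂[F] r : {r : Fin m // r ∉ S}, Dual F (V r))}
    (h : ∀ r hr, L r hr = L' r hr) : slotProduct S L Γ = slotProduct S L' Γ := by
  obtain rfl : L = L' := funext fun r => funext fun hr => h r hr
  rfl

theorem exists_dualDistrib_ne_zero (b : ∀ r, Basis (Fin 2) F (V r)) {t : ⨂[F] r, Dual F (V r)}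
    (ht : t ≠ 0) : ∃ u : ∀ r, V r, (∀ r, u r ≠ 0) ∧
      PiTensorProduct.dualDistrib t (PiTensorProduct.tprod F u) ≠ 0 := by
  by_contra! h
  refine ht ((tensorCoord_bijective b).1 (funext fun I => ?_))
  rw [map_zero]
  exact h _ fun r => (b r).ne_zero _

/-- Lines in a module are spanned by one nonzero vector, provided that the module embeds into an
additive group. -/
theorem finrank_eq_one_iff_exists_span {M N : Type*} [AddCommMonoid M] [Module F M]
    [AddCommGroup N] [Module F N] (f : M →ₗ[F] N) (hf : Function.Injective f)
    (Γ : Submodule F M) : finrank F Γ = 1 ↔ ∃ γ, γ ≠ 0 ∧ Γ = F ∙ γ := by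
  rw [(Submodule.equivMapOfInjective f hf Γ).finrank_eq]
  constructor
  · intro h
    obtain ⟨⟨_, γ, hγ, rfl⟩, hγ0, hspan⟩ := finrank_eq_one_iff'.mp h
    refine ⟨γ, ?_, le_antisymm (fun x hx => ?_) ?_⟩
    · rintro rfl
      exact hγ0 (Subtype.ext (map_zero f))
    · obtain ⟨s, hs⟩ := hspan ⟨f x, x, hx, rfl⟩
      have hs' : s • f γ = f x := congrArg Subtype.val hs
      rw [← map_smul] at hs'
      exact Submodule.mem_span_singleton.mpr ⟨s, hf hs'⟩
    · rw [Submodule.span_singleton_le_iff_mem]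
      exact hγ
  · rintro ⟨γ, hγ, rfl⟩
    rw [Submodule.map_span, Set.image_singleton]
    refine finrank_span_singleton fun h => hγ (hf ?_)
    rw [h, map_zero]

end FillSlots

/-! ### Annihilators of points of the projective line -/

section Annihilator

variable {F : Type*} [Field F] {A : Type*} [AddCommGroup A] [Module F A]

/-- The linear isomorphism between coordinate vectors `x` and linear forms `x₀ e₁^* - x₁ e₀^*`,
which sends `x` to a generator of the annihilator of the point with coordinates `x`. -/
def annihilatorForm (b : Basis (Fin 2) F A) : (Fin 2 → F) ≃ₗ[F] Dual F A where
  toFun x := x 0 • b.coord 1 - x 1 • b.coord 0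
  map_add' x y := by
    simp only [Pi.add_apply, add_smul]
    abel
  map_smul' t x := by
    simp only [Pi.smul_apply, smul_eq_mul, mul_smul, smul_sub, RingHom.id_apply]
  invFun f := ![f (b 1), -f (b 0)]
  left_inv x := by
    funext a
    fin_cases a <;> simp
  right_inv f := b.ext fun a => by
    fin_cases a <;> simp

theorem annihilatorForm_apply (b : Basis (Fin 2) F A) (x : Fin 2 → F) (v : A) :
    annihilatorForm b x v = x 0 * b.equivFun v 1 - x 1 * b.equivFun v 0 := by
  simp [annihilatorForm, Basis.equivFun_apply]

theorem dualAnnihilator_submodule_mk (b : Basis (Fin 2) F A) {v : A} (hv : v ≠ 0) :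
    (Projectivization.mk F v hv).submodule.dualAnnihilator =
      F ∙ annihilatorForm b (b.equivFun v) := by
  ext f
  rw [Submodule.mem_dualAnnihilator, Submodule.mem_span_singleton, Projectivization.submodule_mk]
  constructor
  · intro h
    obtain ⟨y, rfl⟩ := (annihilatorForm b).surjective f
    have h0 := h v (Submodule.mem_span_singleton_self v)
    rw [annihilatorForm_apply] at h0
    obtain ⟨t, ht⟩ := exists_eq_smul_of_det_eq_zero
      ((LinearEquiv.map_ne_zero_iff b.equivFun).mpr hv) (x := y) (by linear_combination h0)
    exact ⟨t, by rw [ht, map_smul]⟩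
  · rintro ⟨t, rfl⟩ w hw
    obtain ⟨s, rfl⟩ := Submodule.mem_span_singleton.mp hw
    rw [LinearMap.smul_apply, annihilatorForm_apply, map_smul]
    simp only [Pi.smul_apply, smul_eq_mul]
    ring

end Annihilator

/-! ### Decomposable curves -/

section Decomposable

variable {m : ℕ} {V : Fin m → Type*} [∀ r, AddCommGroup (V r)] [∀ r, Module ℝ (V r)]
  {H : Type*} [AddCommGroup H] [Module ℝ H] {φ : H →ₗ[ℝ] ⨂[ℝ] r, Dual ℝ (V r)}
  {b : ∀ r, Basis (Fin 2) ℝ (V r)} {n : ℕ} {c : Basis (Fin n) ℝ H} {j : Fin m}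
  {d : Fin m → ℕ} {p : Fin m → Fin n → MvPolynomial (Fin 2) ℝ}

theorem IsCurveForm.map_mem_slotAnnihilator {d : ℕ} {p : Fin n → MvPolynomial (Fin 2) ℝ}
    (hp : IsCurveForm (coordMatrix φ b c) j d p) {v : V j} (hv : v ≠ 0) :
    φ (c.equivFun.symm (evalForms p ((b j).equivFun v))) ∈
      slotAnnihilator j (Projectivization.mk ℝ v hv) :=
  (map_mem_slotAnnihilator_iff hv _).mpr (hp.contractsToZero _)

/-- The value at `ω` of the transformations `g r` in the slots `r ∈ S`, and zero elsewhere. -/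
def slotValues {S : Finset (Fin m)} (g : ∀ r ∈ S, Dual ℝ (V j) ≃ₗ[ℝ] Dual ℝ (V r))
    (ω : Dual ℝ (V j)) (r : Fin m) : Dual ℝ (V r) :=
  if hr : r ∈ S then g r hr ω else 0

theorem slotValues_of_mem {S : Finset (Fin m)} (g : ∀ r ∈ S, Dual ℝ (V j) ≃ₗ[ℝ] Dual ℝ (V r))
    (ω : Dual ℝ (V j)) {r : Fin m} (hr : r ∈ S) : slotValues g ω r = g r hr ω := by
  simp [slotValues, hr]

theorem slotProduct_annihilator (b : ∀ r, Basis (Fin 2) ℝ (V r)) {S : Finset (Fin m)}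
    (g : ∀ r ∈ S, Dual ℝ (V j) ≃ₗ[ℝ] Dual ℝ (V r))
    (γ : ⨂[ℝ] r : {r : Fin m // r ∉ S}, Dual ℝ (V r)) {v : V j} (hv : v ≠ 0) :
    slotProduct S (fun r hr => (Projectivization.mk ℝ v hv).submodule.dualAnnihilator.map
        (g r hr : Dual ℝ (V j) →ₗ[ℝ] Dual ℝ (V r))) (ℝ ∙ γ) =
      ℝ ∙ fillSlots S (slotValues g (annihilatorForm (b j) ((b j).equivFun v))) γ := by
  rw [← slotProduct_span_singleton b]
  refine slotProduct_congr fun r hr => ?_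
  rw [dualAnnihilator_submodule_mk (b j), Submodule.map_span, Set.image_singleton,
    slotValues_of_mem g _ hr]
  rfl

variable [Nontrivial H]

/-- In decomposed form, the tensors on the curve are nonzero multiples of the product of the
`g r ω`, where `ω` annihilates the parameter, with a fixed tensor `γ`. -/
theorem IsDecomposedForm.exists_eq_smul_fillSlots (hφ : Function.Injective φ)
    (hA : HasGenericKernelLine (coordMatrix φ b c) j) {d : ℕ}
    {p : Fin n → MvPolynomial (Fin 2) ℝ} (hp : IsCurveForm (coordMatrix φ b c) j d p)
    {S : Finset (Fin m)} {Γ : Submodule ℝ (⨂[ℝ] r : {r : Fin m // r ∉ S}, Dual ℝ (V r))}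
    {g : ∀ r ∈ S, Dual ℝ (V j) ≃ₗ[ℝ] Dual ℝ (V r)} (h : IsDecomposedForm φ j S Γ g) :
    ∃ γ, ∀ v : V j, v ≠ 0 →
      φ (c.equivFun.symm (evalForms p ((b j).equivFun v))) ≠ 0 ∧
      ∃ t : ℝ, φ (c.equivFun.symm (evalForms p ((b j).equivFun v))) =
        t • fillSlots S (slotValues g (annihilatorForm (b j) ((b j).equivFun v))) γ := by
  obtain ⟨γ, -, rfl⟩ := (finrank_eq_one_iff_exists_span
    (tensorCoord fun r : {r : Fin m // r ∉ S} => b r) (tensorCoord_bijective _).1 Γ).mp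
    h.finrank_eq_one
  refine ⟨γ, fun v hv => ⟨fun h0 => ?_, ?_⟩⟩
  · rw [← map_zero φ] at h0
    exact hp.evalForms_ne_zero ((LinearEquiv.map_ne_zero_iff _).mpr hv)
      ((LinearEquiv.map_eq_zero_iff _).mp (hφ h0))
  · have hc := h.curve_eq (Projectivization.mk ℝ v hv)
    rw [slotProduct_annihilator b, submodule_factorizationCurve hA hp, Submodule.map_span,
      Set.image_singleton] at hc
    obtain ⟨t, ht⟩ := Submodule.mem_span_singleton.mp
      (hc ▸ Submodule.mem_span_singleton_self (R := ℝ) _)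
    exact ⟨t, ht.symm⟩

/-- If the tensors on the curve `p` contract to zero in another slot with a point that depends
on the parameter by a projective transformation, then the curve of that slot has the same image
as `p`. -/
theorem isSubcurve_of_contractsToZero {κ : Type*} [Fintype κ]
    {A : Matrix (Fin m → Fin 2) κ ℝ} {r : Fin m} {d e : ℕ} {p q : κ → MvPolynomial (Fin 2) ℝ}
    (hA : HasGenericKernelLine A r) (hp : IsCurveForm A j d p) (hq : IsCurveForm A r e q)
    (E : (Fin 2 → ℝ) ≃ₗ[ℝ] (Fin 2 → ℝ))
    (h : ∀ x, x ≠ 0 → ContractsToZero r (E x) (A.mulVec (evalForms p x))) :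
    IsSubcurve p q ∧ IsSubcurve q p := by
  have heval : ∀ y, evalForms (fun k => bind₁ (linearForms E.symm.toLinearMap) (p k)) y =
      evalForms p (E.symm y) := fun y => funext fun k => 
    eval_bind₁_linearForms E.symm.toLinearMap (p k) y
  obtain ⟨-, t, ht, hpq⟩ := hq.unique (q := fun k => bind₁ (linearForms E.symm.toLinearMap) (p k))
    hA (hp.coprime.bind₁ hp.homogeneous (noCommonFactor_linearForms E.symm))
    (fun k => isHomogeneous_bind₁ (hp.homogeneous k) (linearForms_isHomogeneous _))
    (X_ne_zero 0) fun y hy => by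
      have hy0 : y ≠ 0 := by
        rintro rfl
        simp at hy
      have := h (E.symm y) ((LinearEquiv.map_ne_zero_iff _).mpr hy0)
      rwa [LinearEquiv.apply_symm_apply, ← heval] at this
  simp only [heval] at hpq
  refine ⟨fun x hx => ⟨E x, (LinearEquiv.map_ne_zero_iff _).mpr hx, t, ht, ?_⟩,
    fun y hy => ⟨E.symm y, (LinearEquiv.map_ne_zero_iff _).mpr hy, t⁻¹, inv_ne_zero ht, ?_⟩⟩
  · rw [← hpq, LinearEquiv.symm_apply_apply]
  · rw [hpq, inv_smul_smul₀ ht]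

/-- The slots of a decomposed form belong to curves equivalent to the given one. -/
theorem IsDecomposedForm.equivalent (hφ : Function.Injective φ)
    (hA : ∀ r, HasGenericKernelLine (coordMatrix φ b c) r)
    (hp : ∀ r, IsCurveForm (coordMatrix φ b c) r (d r) (p r))
    {S : Finset (Fin m)} {Γ : Submodule ℝ (⨂[ℝ] r : {r : Fin m // r ∉ S}, Dual ℝ (V r))}
    {g : ∀ r ∈ S, Dual ℝ (V j) ≃ₗ[ℝ] Dual ℝ (V r)} (h : IsDecomposedForm φ j S Γ g)
    {r : Fin m} (hr : r ∈ S) : Equivalent φ r j := by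
  obtain ⟨γ, hγ⟩ := h.exists_eq_smul_fillSlots hφ (hA j) (hp j)
  rw [equivalent_iff_isSubcurve (hA r) (hp r) (hA j) (hp j)]
  -- The point with coordinates `E x` is annihilated by `g r ω`, where `ω` annihilates `x`.
  let E : (Fin 2 → ℝ) ≃ₗ[ℝ] (Fin 2 → ℝ) :=
    ((annihilatorForm (b j)).trans (g r hr)).trans (annihilatorForm (b r)).symm
  refine (isSubcurve_of_contractsToZero (hA r) (hp j) (hp r) E fun x hx => ?_).symm
  have hv : (b j).equivFun.symm x ≠ 0 := (LinearEquiv.map_ne_zero_iff _).mpr hx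
  have hw : (b r).equivFun.symm (E x) ≠ 0 :=
    (LinearEquiv.map_ne_zero_iff _).mpr ((LinearEquiv.map_ne_zero_iff _).mpr hx)
  obtain ⟨-, t, ht⟩ := hγ _ hv
  rw [LinearEquiv.apply_symm_apply] at ht
  have hmem := map_mem_slotAnnihilator_iff (φ := φ) (b := b) (c := c) hw (evalForms (p j) x)
  rw [LinearEquiv.apply_symm_apply] at hmem
  rw [← hmem, mem_slotAnnihilator_iff]
  intro u
  rw [ht, map_smul, LinearMap.smul_apply, dualDistrib_fillSlots, Finset.prod_eq_zero hr, zero_mul,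
    smul_zero]
  have hE : g r hr (annihilatorForm (b j) x) = annihilatorForm (b r) (E x) := by simp [E]
  rw [Function.update_self, slotValues_of_mem g _ hr, hE, annihilatorForm_apply,
    LinearEquiv.apply_symm_apply]
  ring

/-- The equivalence class of a curve has at most as many members as its degree. -/
theorem ncard_equivalent_le (hφ : Function.Injective φ)
    (hA : ∀ r, HasGenericKernelLine (coordMatrix φ b c) r)
    (hp : ∀ r, IsCurveForm (coordMatrix φ b c) r (d r) (p r)) :
    {i : Fin m | Equivalent φ i j}.ncard ≤ d j := by
  classical
  rw [Set.ncard_eq_toFinset_card']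
  refine (card_le_and_exists_decomposition (coordMatrix_injective hφ) (hp j) _ hp
    fun r hr => ?_).1
  rw [Set.mem_toFinset] at hr
  exact ((equivalent_iff_isSubcurve (hA r) (hp r) (hA j) (hp j)).mp hr).symm

/-- The `deg ψ_j` slots of a decomposed form exhaust the equivalence class, which cannot be
larger. -/
theorem IsDecomposedForm.isDecomposable (hφ : Function.Injective φ)
    (hA : ∀ r, HasGenericKernelLine (coordMatrix φ b c) r)
    (hp : ∀ r, IsCurveForm (coordMatrix φ b c) r (d r) (p r))
    {S : Finset (Fin m)} {Γ : Submodule ℝ (⨂[ℝ] r : {r : Fin m // r ∉ S}, Dual ℝ (V r))}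
    {g : ∀ r ∈ S, Dual ℝ (V j) ≃ₗ[ℝ] Dual ℝ (V r)} (h : IsDecomposedForm φ j S Γ g) :
    IsDecomposable φ j := by
  refine le_antisymm ?_ ?_
  · rw [degree_factorizationCurve (hA j) (hp j)]
    exact ncard_equivalent_le hφ hA hp
  · rw [← h.card_eq, ← Set.ncard_coe_finset]
    exact Set.ncard_le_ncard (fun r hr => h.equivalent hφ hA hp hr) (Set.toFinite _)

/-- If the equivalence class of a curve has as many members as its degree, then the slots of its
members carry linear pairs of forms in the parameter, and the other slots a constant tensor. -/
theorem IsDecomposable.exists_isDecomposedForm (hφ : Function.Injective φ)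
    (hA : ∀ r, HasGenericKernelLine (coordMatrix φ b c) r)
    (hp : ∀ r, IsCurveForm (coordMatrix φ b c) r (d r) (p r)) (h : IsDecomposable φ j) :
    ∃ (S : Finset (Fin m)) (Γ : Submodule ℝ (⨂[ℝ] r : {r : Fin m // r ∉ S}, Dual ℝ (V r)))
      (g : ∀ r ∈ S, Dual ℝ (V j) ≃ₗ[ℝ] Dual ℝ (V r)), IsDecomposedForm φ j S Γ g := by
  classical
  set S : Finset (Fin m) := {i : Fin m | Equivalent φ i j}.toFinset with hS
  have hcard : S.card = d j := by
    rw [← degree_factorizationCurve (hA j) (hp j), ← h, Set.ncard_eq_toFinset_card']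
  obtain ⟨l, ρ, hl, hl1, hlρ, hρ⟩ := (card_le_and_exists_decomposition
    (coordMatrix_injective hφ) (hp j) S hp fun r hr => by
      rw [hS, Set.mem_toFinset] at hr
      exact ((equivalent_iff_isSubcurve (hA r) (hp r) (hA j) (hp j)).mp hr).symm).2 hcard
  -- The linear pair `l r` gives a linear isomorphism from parameters to covectors on `V r`.
  have hE : ∀ r ∈ S, ∃ E : (Fin 2 → ℝ) ≃ₗ[ℝ] Dual ℝ (V r),
      ∀ x a, E x (b r a) = eval x (l r a) := fun r hr => by
    let L : (Fin 2 → ℝ) →ₗ[ℝ] (Fin 2 → ℝ) :=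
      { toFun := fun x a => eval x (l r a)
        map_add' := fun x y => funext fun a => by
          have h := eval_eq_sum_of_isHomogeneous_one (hl1 r hr a)
          rw [Pi.add_apply, h (x + y), h x, h y]
          simp only [Pi.add_apply, add_mul, Finset.sum_add_distrib]
        map_smul' := fun t x => funext fun a => by
          simp [eval_smul_of_isHomogeneous (hl1 r hr a)] }
    have hL : Function.Injective L := by
      rw [← LinearMap.ker_eq_bot, LinearMap.ker_eq_bot']
      intro x hx
      by_contra hx0
      obtain ⟨a, ha⟩ := (hl r hr).exists_eval_ne_zero (hl1 r hr) hx0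
      exact ha (congrFun hx a)
    refine ⟨(LinearEquiv.ofInjectiveEndo L hL).trans (b r).dualBasis.equivFun.symm, fun x a => ?_⟩
    rw [LinearEquiv.trans_apply, Basis.equivFun_symm_apply]
    fin_cases a <;> simp [L]
  choose E hE using hE
  let g : ∀ r ∈ S, Dual ℝ (V j) ≃ₗ[ℝ] Dual ℝ (V r) :=
    fun r hr => (annihilatorForm (b j)).symm.trans (E r hr)
  obtain ⟨γ, hγ⟩ := (tensorCoord_bijective fun r : {r : Fin m // r ∉ S} => b r).2
    fun J => ρ fun r => if h : r ∉ S then J ⟨r, h⟩ else 0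
  have hfill : ∀ x, φ (c.equivFun.symm (evalForms (p j) x)) =
      fillSlots S (slotValues g (annihilatorForm (b j) x)) γ := fun x => by
    refine (tensorCoord_bijective b).1 (funext fun I => ?_)
    rw [tensorCoord_map, hlρ, tensorCoord_fillSlots, hγ]
    congr 1
    · refine Finset.prod_congr rfl fun r hr => ?_
      rw [slotValues_of_mem g _ hr, ← hE r hr]
      simp [g]
    · rw [← apply_piecewise_of_apply_update hρ 0 I]
      congr 1
      funext r
      by_cases hr : r ∈ S <;> simp [hr]
  refine ⟨S, ℝ ∙ γ, g, ?_, ?_, fun ℓ => ?_⟩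
  · rw [hcard, degree_factorizationCurve (hA j) (hp j)]
  · refine (finrank_eq_one_iff_exists_span (tensorCoord fun r : {r : Fin m // r ∉ S} => b r)
      (tensorCoord_bijective _).1 _).mpr ⟨γ, ?_, rfl⟩
    rintro rfl
    have hx : (fun _ => 1 : Fin 2 → ℝ) ≠ 0 := fun h => one_ne_zero (congrFun h 0)
    have h0 := hfill fun _ => 1
    rw [map_zero, ← map_zero φ] at h0
    exact (hp j).evalForms_ne_zero hx ((LinearEquiv.map_eq_zero_iff _).mp (hφ h0))
  · induction ℓ using Projectivization.ind with
    | h v hv =>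
      rw [slotProduct_annihilator b, submodule_factorizationCurve (hA j) (hp j),
        Submodule.map_span, Set.image_singleton, hfill]

/-- The slot `j` of the `j`-th curve carries the annihilator of the parameter, so it cannot be one
of the slots in which a decomposed form is constant. -/
theorem IsDecomposedForm.self_mem (hφ : Function.Injective φ)
    (hA : HasGenericKernelLine (coordMatrix φ b c) j) {d : ℕ}
    {p : Fin n → MvPolynomial (Fin 2) ℝ} (hp : IsCurveForm (coordMatrix φ b c) j d p)
    {S : Finset (Fin m)} {Γ : Submodule ℝ (⨂[ℝ] r : {r : Fin m // r ∉ S}, Dual ℝ (V r))}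
    {g : ∀ r ∈ S, Dual ℝ (V j) ≃ₗ[ℝ] Dual ℝ (V r)} (h : IsDecomposedForm φ j S Γ g) : j ∈ S := by
  classical
  by_contra hj
  obtain ⟨γ, hγ⟩ := h.exists_eq_smul_fillSlots hφ hA hp
  -- Contract `γ` in the slot `j` with a vector on which it does not vanish.
  obtain ⟨h0, t, ht⟩ := hγ (b j 0) ((b j).ne_zero 0)
  obtain ⟨u, hu, hne⟩ := exists_dualDistrib_ne_zero b h0
  rw [ht, map_smul, LinearMap.smul_apply, dualDistrib_fillSlots] at hne
  have hγu := right_ne_zero_of_mul (right_ne_zero_of_mul hne)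
  obtain ⟨h0', t', ht'⟩ := hγ (u j) (hu j)
  obtain ⟨u', -, hne'⟩ := exists_dualDistrib_ne_zero b h0'
  rw [ht', map_smul, LinearMap.smul_apply, dualDistrib_fillSlots] at hne'
  have hzero := (mem_slotAnnihilator_iff (hu j)).mp (hp.map_mem_slotAnnihilator (hu j))
    (S.piecewise u' u)
  have hself : Function.update (S.piecewise u' u) j (u j) = S.piecewise u' u := by
    conv_rhs => rw [← Function.update_eq_self j (S.piecewise u' u)]
    simp [hj]
  rw [hself, ht', map_smul, LinearMap.smul_apply, dualDistrib_fillSlots] at hzero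
  have hprod : ∀ a : ∀ r, Dual ℝ (V r), ∏ r ∈ S, a r (S.piecewise u' u r) = ∏ r ∈ S, a r (u' r) :=
    fun a => Finset.prod_congr rfl fun r hr => by simp [hr]
  have hrest : (fun r : {r : Fin m // r ∉ S} => S.piecewise u' u r) =
      fun r : {r : Fin m // r ∉ S} => u r :=
    funext fun r => by simp [r.2]
  rw [hprod, hrest] at hzero
  exact mul_ne_zero (left_ne_zero_of_mul hne')
    (mul_ne_zero (left_ne_zero_of_mul (right_ne_zero_of_mul hne')) hγu) hzero

/-- The transformation in the slot `j` of a decomposed form fixes all annihilators of points. -/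
theorem IsDecomposedForm.map_self_eq (hφ : Function.Injective φ)
    (hA : HasGenericKernelLine (coordMatrix φ b c) j) {d : ℕ}
    {p : Fin n → MvPolynomial (Fin 2) ℝ} (hp : IsCurveForm (coordMatrix φ b c) j d p)
    {S : Finset (Fin m)} {Γ : Submodule ℝ (⨂[ℝ] r : {r : Fin m // r ∉ S}, Dual ℝ (V r))}
    {g : ∀ r ∈ S, Dual ℝ (V j) ≃ₗ[ℝ] Dual ℝ (V r)} (h : IsDecomposedForm φ j S Γ g) (hj : j ∈ S)
    (P : ℙ ℝ (Dual ℝ (V j))) : Projectivization.map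
      (g j hj : Dual ℝ (V j) →ₗ[ℝ] Dual ℝ (V j)) (g j hj).injective P = P := by
  classical
  obtain ⟨γ, hγ⟩ := h.exists_eq_smul_fillSlots hφ hA hp
  induction P using Projectivization.ind with
  | h f hf =>
    obtain ⟨x, rfl⟩ := (annihilatorForm (b j)).surjective f
    have hx : x ≠ 0 := (LinearEquiv.map_ne_zero_iff _).mp hf
    obtain ⟨v, rfl⟩ := (b j).equivFun.surjective x
    have hv : v ≠ 0 := (LinearEquiv.map_ne_zero_iff _).mp hx
    obtain ⟨h0, t, ht⟩ := hγ v hv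
    obtain ⟨u, -, hne⟩ := exists_dualDistrib_ne_zero b h0
    have hzero := (mem_slotAnnihilator_iff hv).mp (hp.map_mem_slotAnnihilator hv) u
    rw [ht, map_smul, LinearMap.smul_apply, dualDistrib_fillSlots] at hne hzero
    have hrest : (fun r : {r : Fin m // r ∉ S} => Function.update u j v r) =
      fun r : {r : Fin m // r ∉ S} => u r :=
      funext fun r => by
        have : (r : Fin m) ≠ j := fun h => r.2 (h ▸ hj)
        simp [this]
    rw [hrest] at hzero
    have hprod := (smul_eq_zero.mp hzero).resolve_left (left_ne_zero_of_mul hne)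
    have hprod' := (mul_eq_zero.mp hprod).resolve_right
      (right_ne_zero_of_mul (right_ne_zero_of_mul hne))
    obtain ⟨r, hr, hr0⟩ := Finset.prod_eq_zero_iff.mp hprod'
    obtain rfl : r = j := by
      by_contra hrj
      rw [Function.update_of_ne hrj] at hr0
      exact left_ne_zero_of_mul (right_ne_zero_of_mul hne) (Finset.prod_eq_zero hr hr0)
    rw [Function.update_self, slotValues_of_mem g _ hj] at hr0
    have hmem : g r hj (annihilatorForm (b r) ((b r).equivFun v)) ∈
        (Projectivization.mk ℝ v hv).submodule.dualAnnihilator := by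
      rw [Submodule.mem_dualAnnihilator, Projectivization.submodule_mk]
      intro w hw
      obtain ⟨s, rfl⟩ := Submodule.mem_span_singleton.mp hw
      rw [map_smul, hr0, smul_zero]
    rw [dualAnnihilator_submodule_mk (b r) hv] at hmem
    obtain ⟨s, hs⟩ := Submodule.mem_span_singleton.mp hmem
    rw [Projectivization.map_mk]
    exact (Projectivization.mk_eq_mk_iff' ℝ _ _ _ _).mpr ⟨s, hs⟩

end Decomposable

end FactorizationStructure

end

open FactorizationStructure in
theorem theorem2p11 {m : ℕ} {V : Fin m → Type*} [∀ r, AddCommGroup (V r)] [∀ r, Module ℝ (V r)]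
    {H : Type*} [AddCommGroup H] [Module ℝ H] [Nontrivial H]
    (φ : H →ₗ[ℝ] ⨂[ℝ] r, Dual ℝ (V r)) (hφ : IsFactorizationStructure φ) (j : Fin m) :
    (IsDecomposable φ j ↔ IsDecomposable (complexification φ) j) ∧
    (IsDecomposable φ j ↔
      ∃ (S : Finset (Fin m)) (Γ : Submodule ℝ (⨂[ℝ] r : {r : Fin m // r ∉ S}, Dual ℝ (V r)))
        (g : ∀ r ∈ S, Dual ℝ (V j) ≃ₗ[ℝ] Dual ℝ (V r)), IsDecomposedForm φ j S Γ g) ∧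
    (∀ (S : Finset (Fin m)) (Γ : Submodule ℝ (⨂[ℝ] r : {r : Fin m // r ∉ S}, Dual ℝ (V r)))
        (g : ∀ r ∈ S, Dual ℝ (V j) ≃ₗ[ℝ] Dual ℝ (V r)), IsDecomposedForm φ j S Γ g →
      ∃ hj : j ∈ S, ∀ p : ℙ ℝ (Dual ℝ (V j)),
        Projectivization.map (g j hj : Dual ℝ (V j) →ₗ[ℝ] Dual ℝ (V j)) (g j hj).injective p = p) := by
  have := fun r => Module.finite_of_finrank_eq_succ (hφ.finrank_slot r)
  have := Module.finite_of_finrank_eq_succ hφ.finrank_source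
  let b : ∀ r, Basis (Fin 2) ℝ (V r) := fun r => finBasisOfFinrankEq ℝ (V r) (hφ.finrank_slot r)
  let c : Basis (Fin (m + 1)) ℝ H := finBasisOfFinrankEq ℝ H hφ.finrank_source
  have hA := hφ.hasGenericKernelLine (b := b) (c := c)
  choose d p hp using fun i => (hA i).exists_isCurveForm
  refine ⟨decomposable_iff_complexification hφ b c j,
    ⟨fun h => h.exists_isDecomposedForm hφ.injective hA hp, ?_⟩, fun S Γ g h => ?_⟩
  · rintro ⟨S, Γ, g, h⟩
    exact h.isDecomposable hφ.injective hA hp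
  · have hj := h.self_mem hφ.injective (hA j) (hp j)
    exact ⟨hj, h.map_self_eq hφ.injective (hA j) (hp j) hj⟩
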